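/- Let $d\ge 1$ be an integer and let $q\colon\mathbb Z^d\to[0,\infty]$ be an even function, $q(-x)=q(x)$, for which the limit $$s:=-\lim_{|x|\to\infty}\frac{\log q(x)}{\log|x|}$$ exists and satisfies $s\in(d,2d)$, where $|x|$ is the Euclidean norm. Consider the random graph with vertex set $\mathbb Z^d$ that contains all nearest-neighbor edges of $\mathbb Z^d$ and in which, in addition, each unordered pair of distinct sites $x,y$ is joined by an edge with probability $p_{xy}:=1-e^{-q(x-y)}$ (with $e^{-\infty}=0$), independently of all other pairs. For an integer $L\ge1$ let $\mathbb G_L$ be the restriction of this graph to the vertices in, and the edges with both endpoints in, the box $\Lambda_L:=[-L,L]^d\cap\mathbb Z^d$, and let $D_L:=\max_{x,y\in\Lambda_L}D_L(x,y)$ be its diameter, where $D_L(x,y)$ is the graph distance in $\mathbb G_L$. Then for every $\epsilon>0$, $$\lim_{L\to\infty}\mathbb P\bigl((\log L)^{\Delta-\epsilon}\le D_L\le(\log L)^{\Delta+\epsilon}\bigr)=1,\qquad \Delta:=\frac{\log 2}{\log(2d/s)}.$$ -/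

import Mathlib

open Filter Topology MeasureTheory ProbabilityTheory
open scoped ENNReal

namespace LongRangePercolation

noncomputable section

/-- The Euclidean norm `|x|` of a lattice point `x ∈ ℤ^d`. -/
def latticeNorm {d : ℕ} (x : Fin d → ℤ) : ℝ :=
  ‖(WithLp.toLp 2 (fun i => (x i : ℝ)) : EuclideanSpace ℝ (Fin d))‖

/-- The existence of the limit `s = - lim_{|x| → ∞} log q(x) / log |x|`, where `s` is a real number.
Here `ENNReal.log` takes values in `[-∞, ∞]`, with `log 0 = -∞` and `log ∞ = ∞`. -/
def HasDecayExponent {d : ℕ} (q : (Fin d → ℤ) → ℝ≥0∞) (s : ℝ) : Prop :=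
  Tendsto (fun x => -(ENNReal.log (q x) / ((Real.log (latticeNorm x) : ℝ) : EReal)))
    (comap latticeNorm atTop) (𝓝 (s : EReal))

/-- The probability `1 - e^{-a}`, for `a ∈ [0, ∞]` (with `e^{-∞} = 0`). -/
def openProb (a : ℝ≥0∞) : unitInterval :=
  ⟨(1 - EReal.exp (-(a : EReal))).toReal, ENNReal.toReal_nonneg,
    ENNReal.toReal_le_of_le_ofReal zero_le_one (by simp)⟩

/-- The probability `p_{xy} = 1 - e^{-q(x-y)}` attached to the unordered pair `{x, y}`. -/
def edgeProb {d : ℕ} (q : (Fin d → ℤ) → ℝ≥0∞) (hq : Function.Even q) :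
    Sym2 (Fin d → ℤ) → unitInterval :=
  Sym2.lift ⟨fun x y => openProb (q (x - y)), fun x y => by
    have h := hq (x - y)
    rw [neg_sub] at h
    simp only [h]⟩

/-- A configuration tells, for each unordered pair of sites, whether the pair has been added as an
edge. (The values at the diagonal pairs `{x, x}` play no role.) -/
abbrev Config (d : ℕ) : Type := Sym2 (Fin d → ℤ) → Bool

/-- The law of long-range percolation: the pairs are open independently of each other, the pair
`{x, y}` with probability `p_{xy} = 1 - e^{-q(x-y)}`. -/
def percMeasure {d : ℕ} (q : (Fin d → ℤ) → ℝ≥0∞) (hq : Function.Even q) : Measure (Config d) :=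
  Measure.infinitePi fun e => bernoulliMeasure true false (edgeProb q hq e)

/-- The nearest-neighbor graph of `ℤ^d`. -/
def nnGraph (d : ℕ) : SimpleGraph (Fin d → ℤ) where
  Adj x y := ∑ i, |x i - y i| = 1
  symm := ⟨fun x y h => by simpa only [abs_sub_comm] using h⟩
  loopless := ⟨fun x h => by simp at h⟩

/-- The random graph: the nearest-neighbor edges of `ℤ^d` together with all open edges. -/
def percGraph {d : ℕ} (ω : Config d) : SimpleGraph (Fin d → ℤ) :=
  nnGraph d ⊔ SimpleGraph.fromEdgeSet {e | ω e = true}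

/-- The box `Λ_L = [-L, L]^d ∩ ℤ^d`. -/
def box (d L : ℕ) : Set (Fin d → ℤ) := {x | ∀ i, |x i| ≤ (L : ℤ)}

/-- The diameter `D_L` of the graph restricted to the vertices of `Λ_L` and the edges with both
endpoints in `Λ_L`. -/
def boxDiam {d : ℕ} (ω : Config d) (L : ℕ) : ℕ∞ :=
  ((percGraph ω).induce (box d L)).ediam

/-- The exponent `Δ = log 2 / log (2d / s)`. -/
def diamExponent (d : ℕ) (s : ℝ) : ℝ := Real.log 2 / Real.log (2 * d / s)

end

end LongRangePercolation

namespace LongRangePercolation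

noncomputable section

variable {d : ℕ}

/-! The exponent comes from the heuristic recursion D(N) ≈ 2 D(N^(s/2d)). Two balls of radius m
around points at distance N contain about m^(2d) pairs, each open with probability about N^(-s), so
a direct edge between them appears once m is about N^(s/2d). Halving the problem in this way about
log log L / log(2d/s) times costs a factor (log L)^Δ. Each bound on the diameter makes one direction
of this rigorous. Sites are compared in the sup norm `‖x - y‖`, and s is replaced by a slightly
smaller or larger exponent so that q obeys clean power bounds.

Lower bound. A geodesic of length m from o to x has an edge of length at least ‖o - x‖ / m.
Exploring the ball around o up to this edge leaves the edge and the rest of the geodesic independent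
of what was seen, so the connection probability is bounded by a product of three factors
(`measureReal_geodesic_split`). Summing over the endpoints of the edge bounds it by ‖o - x‖^(-a)
times a product of two expected ball volumes whose radii add up to at most j. Concavity of j^α gives
a factor 2^(1-α) in the exponent, and the induction closes with expected volume at most exp(A j^α)
whenever 2^(1-α) d < a (`exists_sum_measureReal_le`). For a near s this says α > 1/Δ. If j is about
(log L)^(Δ-ε), the volumes are L^o(1), while opposite corners of the box cost L^(-a).

Upper bound. If all points at distance at most m^g have an edge between their m-neighborhoods, graph
distances at scale m^g are at most twice those at scale m, plus one. This fails with probability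
about exp(-m^(2d-bg)) per pair, which beats the number of pairs in the box only if m is at least a
power of x = log L. Starting at such a scale from the lattice distance would spoil the exponent.
Therefore the hierarchy is run on a random sparse set of good cubes, of side R = x^K, whose diameter
is at most a small power of x. A given cube is good with probability tending to 1, so among n = x²
disjoint translates one is good with overwhelming probability. The good set has density 1/n and
depends only on edges shorter than those used in the hierarchy, which keeps independence
(`measureReal_not_connectedAt_le`). Nearby good cubes overlap or are joined by an edge, and
arbitrary points reach the good set within x^(Δ+ε/2) steps, which rests on Δ(2d - s) ≥ 1
(`one_le_diamExponent_mul`). `measureReal_diam_le` combines these parts. -/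

instance (q : (Fin d → ℤ) → ℝ≥0∞) (hq : Function.Even q) :
    IsProbabilityMeasure (percMeasure q hq) := by
  unfold percMeasure; infer_instance

/-! ### Local events and their independence -/

/-- The event `A` is determined by the states of the finitely many pairs in `S`. -/
structure IsLocal (A : Set (Config d)) (S : Set (Sym2 (Fin d → ℤ))) : Prop where
  finite : S.Finite
  dep : ∀ ω ω' : Config d, (∀ e ∈ S, ω e = ω' e) → ω ∈ A → ω' ∈ A

namespace IsLocal

variable {A B : Set (Config d)} {S T : Set (Sym2 (Fin d → ℤ))}

theorem inter (hA : IsLocal A S) (hB : IsLocal B T) : IsLocal (A ∩ B) (S ∪ T) :=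
  ⟨hA.finite.union hB.finite, fun ω ω' he hω =>
    ⟨hA.dep ω ω' (fun e h => he e (Or.inl h)) hω.1, hB.dep ω ω' (fun e h => he e (Or.inr h)) hω.2⟩⟩

/-- Finitely many bits form a finite discrete space, where every set is measurable. Measurability
and independence of local events therefore follow from this form without any further check on `A`.
-/
theorem preimage_restrict (hA : IsLocal A S) :
    A = (fun ω : Config d => fun e : hA.finite.toFinset => ω e) ⁻¹'
      ((fun ω : Config d => fun e : hA.finite.toFinset => ω e) '' A) := by
  refine (Set.subset_preimage_image _ _).antisymm ?_
  rintro ω ⟨ω', hω', h⟩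
  refine hA.dep ω' ω (fun e he => ?_) hω'
  exact congrFun h ⟨e, by simpa using he⟩

theorem measurableSet (hA : IsLocal A S) : MeasurableSet A := by
  rw [hA.preimage_restrict]
  exact (measurable_pi_lambda _ fun e => measurable_pi_apply _) (Set.toFinite _).measurableSet

theorem measure_inter (q : (Fin d → ℤ) → ℝ≥0∞) (hq : Function.Even q) (hA : IsLocal A S)
    (hB : IsLocal B T) (hST : Disjoint S T) :
    (percMeasure q hq).real (A ∩ B) = (percMeasure q hq).real A * (percMeasure q hq).real B := by
  have hind : iIndepFun (fun e (ω : Config d) => ω e) (percMeasure q hq) :=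
    iIndepFun_infinitePi (X := fun _ b => b) (fun _ => measurable_id)
  have h := hind.indepFun_finset hA.finite.toFinset hB.finite.toFinset
    (by rw [← Finset.disjoint_coe]; simpa using hST) fun e => measurable_pi_apply e
  have h2 := h.measure_inter_preimage_eq_mul (s := ((fun ω : Config d =>
      fun e : hA.finite.toFinset => ω e) '' A)) (t := ((fun ω : Config d =>
      fun e : hB.finite.toFinset => ω e) '' B))
      (Set.toFinite _).measurableSet (Set.toFinite _).measurableSet
  rw [← hA.preimage_restrict, ← hB.preimage_restrict] at h2
  simp only [measureReal_def, h2, ENNReal.toReal_mul]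

end IsLocal

/-! ### Edge probabilities and power bounds from the decay exponent -/

theorem measureReal_edge_true (q : (Fin d → ℤ) → ℝ≥0∞) (hq : Function.Even q)
    (e : Sym2 (Fin d → ℤ)) :
    (percMeasure q hq).real {ω | ω e = true} = edgeProb q hq e := by
  have h := Measure.infinitePi_map_eval (fun e => bernoulliMeasure true false (edgeProb q hq e)) e
  have h2 : (percMeasure q hq) {ω | ω e = true} =
      (bernoulliMeasure true false (edgeProb q hq e)) {true} := by
    rw [← h, Measure.map_apply (measurable_pi_apply e) (measurableSet_singleton _)]
    rfl
  rw [measureReal_def, h2, ← measureReal_def,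
    bernoulliMeasure_real_apply_of_mem_of_notMem] <;> simp

theorem measure_cylinder_false (q : (Fin d → ℤ) → ℝ≥0∞) (hq : Function.Even q)
    (F : Finset (Sym2 (Fin d → ℤ))) :
    (percMeasure q hq).real {ω | ∀ e ∈ F, ω e = false} = ∏ e ∈ F, (1 - (edgeProb q hq e : ℝ)) := by
  have h := Measure.infinitePi_pi (fun e => bernoulliMeasure true false (edgeProb q hq e))
    (s := F) (t := fun _ => {false}) (fun _ _ => measurableSet_singleton _)
  have h2 : {ω : Config d | ∀ e ∈ F, ω e = false} = Set.pi F fun _ => {false} := by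
    ext ω; simp [Set.mem_pi]
  rw [measureReal_def, percMeasure, h2, h, ENNReal.toReal_prod]
  refine Finset.prod_congr rfl fun e _ => ?_
  rw [← measureReal_def, bernoulliMeasure_real_apply_of_notMem_of_mem] <;> simp

theorem exp_neg_toReal {a : ℝ} (ha : 0 ≤ a) : EReal.exp (-((ENNReal.ofReal a : ℝ≥0∞) : EReal)) =
    ENNReal.ofReal (Real.exp (-a)) := by
  rw [EReal.coe_ennreal_ofReal, max_eq_left ha, ← EReal.coe_neg, EReal.exp_coe]

theorem one_sub_openProb_le {a : ℝ} (ha : 0 ≤ a) {b : ℝ≥0∞} (h : ENNReal.ofReal a ≤ b) :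
    1 - (openProb b : ℝ) ≤ Real.exp (-a) := by
  have h1 : EReal.exp (-(b : EReal)) ≤ ENNReal.ofReal (Real.exp (-a)) := by
    rw [← exp_neg_toReal ha]
    exact EReal.exp_monotone (EReal.neg_le_neg_iff.2 (by exact_mod_cast h))
  have h2 : (ENNReal.ofReal (1 - Real.exp (-a))).toReal ≤ (openProb b : ℝ) := by
    refine ENNReal.toReal_mono (ne_top_of_le_ne_top ENNReal.one_ne_top tsub_le_self) ?_
    rw [ENNReal.ofReal_sub _ (Real.exp_nonneg _), ENNReal.ofReal_one]
    exact tsub_le_tsub_left h1 1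
  rw [ENNReal.toReal_ofReal (by simpa using ha)] at h2
  linarith

theorem openProb_le {a : ℝ} (ha : 0 ≤ a) {b : ℝ≥0∞} (h : b ≤ ENNReal.ofReal a) :
    (openProb b : ℝ) ≤ a := by
  have h1 : ENNReal.ofReal (Real.exp (-a)) ≤ EReal.exp (-(b : EReal)) := by
    rw [← exp_neg_toReal ha]
    exact EReal.exp_monotone (EReal.neg_le_neg_iff.2 (by exact_mod_cast h))
  have h2 : (openProb b : ℝ) ≤ (ENNReal.ofReal (1 - Real.exp (-a))).toReal := by
    refine ENNReal.toReal_mono ENNReal.ofReal_ne_top ?_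
    rw [ENNReal.ofReal_sub _ (Real.exp_nonneg _), ENNReal.ofReal_one]
    exact tsub_le_tsub_left h1 1
  rw [ENNReal.toReal_ofReal (by simpa using ha)] at h2
  linarith [Real.add_one_le_exp (-a)]

theorem norm_le_latticeNorm (x : Fin d → ℤ) : ‖x‖ ≤ latticeNorm x := by
  refine (pi_norm_le_iff_of_nonneg (norm_nonneg _)).2 fun i => ?_
  have := PiLp.norm_apply_le (WithLp.toLp 2 (fun i => (x i : ℝ)) : EuclideanSpace ℝ (Fin d)) i
  simpa [latticeNorm, Int.norm_eq_abs] using this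

theorem latticeNorm_le (x : Fin d → ℤ) : latticeNorm x ≤ d * ‖x‖ := by
  have h : (WithLp.toLp 2 (fun i => (x i : ℝ)) : EuclideanSpace ℝ (Fin d)) =
      ∑ i, EuclideanSpace.single i (x i : ℝ) := by
    ext j
    simp [Pi.single_apply]
  rw [latticeNorm, h]
  refine (norm_sum_le _ _).trans ?_
  calc ∑ i, ‖EuclideanSpace.single i (x i : ℝ)‖ ≤ ∑ _i : Fin d, ‖x‖ := by
        refine Finset.sum_le_sum fun i _ => ?_
        simpa [Int.norm_eq_abs] using norm_le_pi_norm x i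
    _ = d * ‖x‖ := by simp

theorem eventually_of_decay {q : (Fin d → ℤ) → ℝ≥0∞} {s : ℝ} (h : HasDecayExponent q s) {a b : ℝ}
    (ha : a < s) (hb : s < b) : ∃ ρ : ℝ, ∀ x, ρ ≤ latticeNorm x →
      ENNReal.ofReal (latticeNorm x ^ (-b)) ≤ q x ∧ q x ≤ ENNReal.ofReal (latticeNorm x ^ (-a)) := by
  have h1 : ∀ᶠ x in comap latticeNorm atTop,
      -(ENNReal.log (q x) / ((Real.log (latticeNorm x) : ℝ) : EReal)) ∈
        Set.Ioo (a : EReal) (b : EReal) :=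
    h.eventually (Ioo_mem_nhds (by exact_mod_cast ha) (by exact_mod_cast hb))
  rw [eventually_comap] at h1
  obtain ⟨ρ, hρ⟩ := eventually_atTop.1 (h1.and (eventually_gt_atTop (1 : ℝ)))
  refine ⟨ρ, fun x hx => ?_⟩
  obtain ⟨h2, h3⟩ := hρ _ hx
  have h4 := h2 x rfl
  have hlog := Real.log_pos h3
  set N := latticeNorm x with hN
  have hN0 : 0 < N := by linarith
  clear_value N
  have key : ∀ c : ℝ, ENNReal.log (ENNReal.ofReal (N ^ (-c))) = ((-c * Real.log N : ℝ) : EReal) := by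
    intro c
    rw [ENNReal.log_ofReal_of_pos (by positivity), Real.log_rpow hN0]
  rw [← ENNReal.log_le_log_iff, ← ENNReal.log_le_log_iff, key, key]
  -- The values q = 0 and q = ∞ would make the ratio infinite, outside the interval (a, b).
  induction hz : ENNReal.log (q x) with
  | bot =>
    rw [hz, EReal.bot_div_of_pos_ne_top (by exact_mod_cast hlog) (by simp)] at h4
    simp at h4
  | top =>
    rw [hz, EReal.top_div_of_pos_ne_top (by exact_mod_cast hlog) (by simp)] at h4
    simp at h4
  | coe z =>
    rw [hz, ← EReal.coe_div, ← EReal.coe_neg] at h4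
    obtain ⟨h5, h6⟩ := h4
    have h5' : a < -(z / Real.log N) := by exact_mod_cast h5
    have h6' : -(z / Real.log N) < b := by exact_mod_cast h6
    rw [← neg_div, lt_div_iff₀ hlog] at h5'
    rw [← neg_div, div_lt_iff₀ hlog] at h6'
    constructor
    · exact_mod_cast (by linarith : -b * Real.log N ≤ z)
    · exact_mod_cast (by linarith : z ≤ -a * Real.log N)

theorem exists_edgeProb_le {q : (Fin d → ℤ) → ℝ≥0∞} (hq : Function.Even q) {s : ℝ}
    (h : HasDecayExponent q s) {a : ℝ} (ha0 : 0 < a) (ha : a < s) :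
    ∃ C : ℝ, 1 ≤ C ∧ ∀ x y, x ≠ y → (edgeProb q hq s(x, y) : ℝ) ≤ C * ‖x - y‖ ^ (-a) := by
  obtain ⟨ρ, hρ⟩ := eventually_of_decay h ha (lt_add_one s)
  -- With this constant the bound is at least 1 for distances below ρ, where nothing is known about
  -- q.
  refine ⟨max 1 ρ ^ a, Real.one_le_rpow (le_max_left _ _) ha0.le, fun x y hxy => ?_⟩
  have hpos : 0 < ‖x - y‖ := norm_pos_iff.2 (sub_ne_zero.2 hxy)
  by_cases hr : ρ ≤ ‖x - y‖
  · have h1 := (hρ (x - y) (hr.trans (norm_le_latticeNorm _))).2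
    have h2 : (edgeProb q hq s(x, y) : ℝ) ≤ latticeNorm (x - y) ^ (-a) :=
      openProb_le (Real.rpow_nonneg (norm_nonneg _) _) h1
    refine h2.trans ((Real.rpow_le_rpow_of_nonpos hpos (norm_le_latticeNorm _) (by linarith)).trans ?_)
    exact le_mul_of_one_le_left (by positivity) (Real.one_le_rpow (le_max_left _ _) ha0.le)
  · refine (edgeProb q hq s(x, y)).2.2.trans ?_
    rw [Real.rpow_neg hpos.le, ← div_eq_mul_inv, ← Real.div_rpow (by positivity) hpos.le]
    refine Real.one_le_rpow ?_ ha0.le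
    rw [one_le_div hpos]
    exact (not_le.1 hr).le.trans (le_max_right _ _)

theorem exists_one_sub_edgeProb_le {q : (Fin d → ℤ) → ℝ≥0∞} (hq : Function.Even q) {s : ℝ}
    (hd : 0 < d) (hs : 0 < s) (h : HasDecayExponent q s) {b : ℝ} (hb : s < b) :
    ∃ ρ : ℝ, 1 ≤ ρ ∧ ∀ x y, ρ ≤ ‖x - y‖ →
      1 - (edgeProb q hq s(x, y) : ℝ) ≤ Real.exp (-‖x - y‖ ^ (-b)) := by
  -- The room between c and b absorbs the factor d^c lost when the Euclidean norm is compared with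
  -- the sup norm.
  obtain ⟨c, hsc, hcb⟩ := exists_between hb
  obtain ⟨ρ, hρ⟩ := eventually_of_decay h (sub_one_lt s) hsc
  have hd' : (0 : ℝ) < d := by exact_mod_cast hd
  have hev : ∀ᶠ r : ℝ in atTop, (d : ℝ) ^ c ≤ r ^ (b - c) :=
    (tendsto_rpow_atTop (by linarith)).eventually_ge_atTop _
  obtain ⟨ρ', hρ'⟩ := eventually_atTop.1 hev
  refine ⟨max 1 (max ρ ρ'), le_max_left _ _, fun x y hxy => ?_⟩
  have h1 : 1 ≤ ‖x - y‖ := (le_max_left _ _).trans hxy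
  have h2 : ρ ≤ ‖x - y‖ := ((le_max_left _ _).trans (le_max_right _ _)).trans hxy
  have h3 : ρ' ≤ ‖x - y‖ := ((le_max_right _ _).trans (le_max_right _ _)).trans hxy
  have h4 := (hρ (x - y) (h2.trans (norm_le_latticeNorm _))).1
  have hpos : 0 < ‖x - y‖ := by linarith
  have hN : 0 < latticeNorm (x - y) := hpos.trans_le (norm_le_latticeNorm _)
  refine one_sub_openProb_le (by positivity) (le_trans (ENNReal.ofReal_le_ofReal ?_) h4)
  calc ‖x - y‖ ^ (-b) ≤ (d * ‖x - y‖) ^ (-c) := by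
        rw [Real.mul_rpow hd'.le hpos.le, Real.rpow_neg hd'.le, ← div_eq_inv_mul,
          le_div_iff₀ (by positivity)]
        calc ‖x - y‖ ^ (-b) * d ^ c ≤ ‖x - y‖ ^ (-b) * ‖x - y‖ ^ (b - c) := by
              gcongr; exact hρ' _ h3
          _ = ‖x - y‖ ^ (-c) := by rw [← Real.rpow_add hpos]; congr 1; ring
    _ ≤ latticeNorm (x - y) ^ (-c) :=
        Real.rpow_le_rpow_of_nonpos hN (latticeNorm_le _) (by linarith)

/-! ### Restrictions of the graph to sets of sites -/

/-- The percolation graph restricted to the vertices in `V`, as a graph on all of `ℤ^d`. -/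
def subGraph (ω : Config d) (V : Set (Fin d → ℤ)) : SimpleGraph (Fin d → ℤ) where
  Adj x y := x ∈ V ∧ y ∈ V ∧ (percGraph ω).Adj x y
  symm := ⟨fun _ _ h => ⟨h.2.1, h.1, h.2.2.symm⟩⟩
  loopless := ⟨fun _ h => h.2.2.ne rfl⟩

/-- The unordered pairs of elements of `V`. -/
def pairs (V : Set (Fin d → ℤ)) : Set (Sym2 (Fin d → ℤ)) := {e | ∀ x ∈ e, x ∈ V}

theorem mk_mem_pairs {V : Set (Fin d → ℤ)} {x y : Fin d → ℤ} :
    s(x, y) ∈ pairs V ↔ x ∈ V ∧ y ∈ V := by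
  simp [pairs]

theorem finite_pairs {V : Set (Fin d → ℤ)} (hV : V.Finite) : (pairs V).Finite := by
  refine ((hV.prod hV).image fun p => s(p.1, p.2)).subset fun e => ?_
  induction e with | _ x y =>
  intro h
  exact ⟨(x, y), mk_mem_pairs.1 h, rfl⟩

theorem percGraph_adj {ω : Config d} {x y : Fin d → ℤ} :
    (percGraph ω).Adj x y ↔ (nnGraph d).Adj x y ∨ (ω s(x, y) = true ∧ x ≠ y) := by
  simp [percGraph]

theorem percGraph_adj_congr {ω ω' : Config d} {x y : Fin d → ℤ} (h : ω s(x, y) = ω' s(x, y)) :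
    (percGraph ω).Adj x y ↔ (percGraph ω').Adj x y := by
  rw [percGraph_adj, percGraph_adj, h]

theorem subGraph_congr {ω ω' : Config d} {V : Set (Fin d → ℤ)}
    (h : ∀ e ∈ pairs V, ω e = ω' e) : subGraph ω V = subGraph ω' V := by
  ext x y
  refine and_congr_right fun hx => and_congr_right fun hy => percGraph_adj_congr ?_
  exact h _ (mk_mem_pairs.2 ⟨hx, hy⟩)

theorem subGraph_mono {ω : Config d} {V W : Set (Fin d → ℤ)} (h : V ⊆ W) :
    subGraph ω V ≤ subGraph ω W :=
  fun _ _ hxy => ⟨h hxy.1, h hxy.2.1, hxy.2.2⟩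

theorem isLocal_of_subGraph {V : Set (Fin d → ℤ)} (hV : V.Finite)
    (p : SimpleGraph (Fin d → ℤ) → Prop) : IsLocal {ω | p (subGraph ω V)} (pairs V) :=
  ⟨finite_pairs hV, fun ω ω' h hω => by
    simpa only [Set.mem_ofPred_eq, subGraph_congr h] using hω⟩

theorem isLocal_adj (x y : Fin d → ℤ) : IsLocal {ω | (percGraph ω).Adj x y} {s(x, y)} :=
  ⟨Set.finite_singleton _, fun _ _ h hω => (percGraph_adj_congr (h _ rfl)).1 hω⟩

theorem norm_le_one_of_nnGraph_adj {x y : Fin d → ℤ} (h : (nnGraph d).Adj x y) : ‖x - y‖ ≤ 1 := by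
  refine (pi_norm_le_iff_of_nonneg zero_le_one).2 fun i => ?_
  have h1 : |x i - y i| ≤ 1 :=
    (Finset.single_le_sum (f := fun i => |x i - y i|) (fun i _ => abs_nonneg _)
      (Finset.mem_univ i)).trans h.le
  rw [Pi.sub_apply, Int.norm_eq_abs]
  exact_mod_cast h1

/-- Nearest-neighbor edges are always present, but their sup-norm length is at most 1, so `1 ≤ C`
lets the same power bound cover them. -/
theorem measureReal_adj_le {q : (Fin d → ℤ) → ℝ≥0∞} {hq : Function.Even q} {C a : ℝ} (ha : 0 < a)
    (hC : 1 ≤ C) (h : ∀ x y, x ≠ y → (edgeProb q hq s(x, y) : ℝ) ≤ C * ‖x - y‖ ^ (-a))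
    {x y : Fin d → ℤ} (hxy : x ≠ y) :
    (percMeasure q hq).real {ω | (percGraph ω).Adj x y} ≤ C * ‖x - y‖ ^ (-a) := by
  have hpos : 0 < ‖x - y‖ := norm_pos_iff.2 (sub_ne_zero.2 hxy)
  by_cases hn : (nnGraph d).Adj x y
  · refine measureReal_le_one.trans ?_
    have h1 : 1 ≤ ‖x - y‖ ^ (-a) :=
      Real.one_le_rpow_of_pos_of_le_one_of_nonpos hpos (norm_le_one_of_nnGraph_adj hn) (by linarith)
    nlinarith
  · refine le_trans ?_ (h x y hxy)
    rw [← measureReal_edge_true]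
    refine measureReal_mono ?_
    intro ω hω
    exact ((percGraph_adj.1 hω).resolve_left hn).1

/-! ### Geodesics and exploration of balls -/

theorem edist_lt_succ_iff {α : Type*} {G : SimpleGraph α} {o y : α} {j : ℕ} :
    G.edist o y < (j + 1 : ℕ) ↔ y = o ∨ ∃ z, G.edist o z < j ∧ G.Adj z y := by
  constructor
  · intro h
    obtain ⟨p, hp⟩ := SimpleGraph.exists_walk_of_edist_ne_top (ne_top_of_lt
      (SimpleGraph.edist_comm (G := G) ▸ h : G.edist y o < (j + 1 : ℕ)))
    cases p with
    | nil => exact Or.inl rfl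
    | @cons _ z _ hyz p =>
      refine Or.inr ⟨z, ?_, hyz.symm⟩
      rw [SimpleGraph.edist_comm, ← hp, SimpleGraph.Walk.length_cons] at h
      rw [SimpleGraph.edist_comm]
      refine (SimpleGraph.edist_le p).trans_lt ?_
      have : p.length + 1 < j + 1 := by exact_mod_cast h
      exact_mod_cast (by omega : p.length < j)
  · rintro (rfl | ⟨z, hz, hzy⟩)
    · rw [SimpleGraph.edist_self]; exact_mod_cast Nat.succ_pos j
    · have h1 : G.edist z y ≤ 1 := SimpleGraph.edist_le_one_iff_adj_or_eq.2 (Or.inl hzy)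
      obtain ⟨n, hn⟩ := ENat.ne_top_iff_exists.1 (ne_top_of_lt hz)
      rw [← hn] at hz
      have hz' : n < j := by exact_mod_cast hz
      refine (SimpleGraph.edist_triangle (v := z)).trans_lt ?_
      rw [← hn]
      refine (add_le_add le_rfl h1).trans_lt ?_
      exact_mod_cast (by omega : n + 1 < j + 1)

theorem exists_geodesic {α : Type*} {G : SimpleGraph α} {o x : α} {n : ℕ} (h : G.edist o x = n) :
    ∃ γ : ℕ → α, γ 0 = o ∧ γ n = x ∧ (∀ i ≤ n, G.edist o (γ i) = i) ∧
      ∀ i < n, G.Adj (γ i) (γ (i + 1)) := by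
  obtain ⟨p, hp⟩ := SimpleGraph.exists_walk_of_edist_eq_coe h
  refine ⟨p.getVert, p.getVert_zero, hp ▸ p.getVert_length, fun i hi => ?_,
    fun i hi => p.adj_getVert_succ (hp ▸ hi)⟩
  have h1 : G.edist o (p.getVert i) ≤ i :=
    (SimpleGraph.edist_le (p.take i)).trans (by
      rw [SimpleGraph.Walk.take_length]; exact_mod_cast min_le_left _ _)
  have h2 : G.edist (p.getVert i) x ≤ (n - i : ℕ) :=
    (SimpleGraph.edist_le (p.drop i)).trans (by rw [SimpleGraph.Walk.drop_length, hp])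
  obtain ⟨k, hk⟩ := ENat.ne_top_iff_exists.1 (ne_top_of_le_ne_top (ENat.natCast_ne_top i) h1)
  have h3 := (SimpleGraph.edist_triangle (G := G) (u := o) (v := p.getVert i) (w := x)).trans
    (add_le_add le_rfl h2)
  rw [← hk] at h1 h3 ⊢
  rw [h] at h3
  have h1' : k ≤ i := by exact_mod_cast h1
  have h3' : n ≤ k + (n - i) := by exact_mod_cast h3
  exact_mod_cast (by omega : k = i)

/-- A geodesic from `o` to `x` contains an edge that is longer than average; behind it the geodesic
avoids the ball around `o` explored before. -/
theorem exists_long_edge {ω : Config d} {V : Set (Fin d → ℤ)} {o x : Fin d → ℤ} {n : ℕ}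
    (hox : o ≠ x) (h : (subGraph ω V).edist o x = n) :
    ∃ k < n, ∃ u ∈ V, ∃ v ∈ V, (subGraph ω V).edist o u = k ∧
      ¬ (subGraph ω V).edist o v < (k + 1 : ℕ) ∧ ‖o - x‖ ≤ n * ‖u - v‖ ∧ (percGraph ω).Adj u v ∧
      (subGraph ω (V \ {y | (subGraph ω V).edist o y < (k + 1 : ℕ)})).edist v x < (n - k : ℕ) := by
  obtain ⟨γ, h0, hn, hγ, hadj⟩ := exists_geodesic h
  have hn0 : 0 < n := by
    rcases Nat.eq_zero_or_pos n with rfl | h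
    · exact absurd (h0.symm.trans hn) hox
    · exact h
  -- By the triangle inequality, n steps that were all shorter than ‖o - x‖ / n could not reach x.
  obtain ⟨k, hk, hlong⟩ : ∃ k < n, ‖o - x‖ ≤ n * ‖γ k - γ (k + 1)‖ := by
    by_contra! hcon
    have h1 : ‖o - x‖ ≤ ∑ i ∈ Finset.range n, ‖γ i - γ (i + 1)‖ := by
      have := norm_sum_le (Finset.range n) fun i => γ i - γ (i + 1)
      rwa [Finset.sum_range_sub', h0, hn] at this
    have h2 : ∑ i ∈ Finset.range n, n * ‖γ i - γ (i + 1)‖ < ∑ _i ∈ Finset.range n, ‖o - x‖ :=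
      Finset.sum_lt_sum_of_nonempty (by simpa using hn0.ne') fun i hi =>
        hcon i (Finset.mem_range.1 hi)
    rw [← Finset.mul_sum] at h2
    have hn0' : (0 : ℝ) < n := by exact_mod_cast hn0
    simp only [Finset.sum_const, Finset.card_range, nsmul_eq_mul] at h2
    exact absurd h1 (not_le.2 (lt_of_mul_lt_mul_left h2 hn0'.le))
  refine ⟨k, hk, γ k, (hadj k hk).1, γ (k + 1), (hadj k hk).2.1, hγ k hk.le, ?_, hlong,
    (hadj k hk).2.2, ?_⟩
  · rw [hγ (k + 1) hk]; exact lt_irrefl _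
  -- The ball with strict radius k + 1 holds the sites at distance at most k. The geodesic from step
  -- k + 1 on stays at distance at least k + 1, hence in `W`.
  · set W := V \ {y | (subGraph ω V).edist o y < (k + 1 : ℕ)} with hW
    have hmem : ∀ i, k + 1 ≤ i → i ≤ n → γ i ∈ W := by
      intro i hi hin
      refine ⟨?_, ?_⟩
      · obtain ⟨i', rfl⟩ : ∃ i', i = i' + 1 := ⟨i - 1, by omega⟩
        exact (hadj i' (by omega)).2.1
      · rw [Set.mem_ofPred_eq, hγ i hin]
        exact_mod_cast not_lt.2 hi
    have hle : ∀ i, k + 1 + i ≤ n → (subGraph ω W).edist (γ (k + 1)) (γ (k + 1 + i)) < (i + 1 : ℕ) := by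
      intro i
      induction i with
      | zero => intro _; simp
      | succ i ih =>
        intro hi
        refine edist_lt_succ_iff.2 (Or.inr ⟨_, ih (by omega), hmem _ (by omega) (by omega),
          hmem _ (by omega) (by omega), (hadj (k + 1 + i) (by omega)).2.2⟩)
    have := hle (n - k - 1) (by omega)
    rw [show k + 1 + (n - k - 1) = n by omega, hn, show n - k - 1 + 1 = n - k by omega] at this
    exact this

/-- An elementary substitute for conditioning: on each cell `E i` the event `F i`, which may depend
on the cell, has conditional probability at most `p`, and the cells are disjoint subsets of `C`. -/
theorem measureReal_le_of_partition {Ω ι : Type*} [MeasurableSpace Ω] {μ : Measure Ω}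
    [IsFiniteMeasure μ] {A C : Set Ω} (I : Finset ι) (E F : ι → Set Ω) {p : ℝ} (hp : 0 ≤ p)
    (hdisj : (I : Set ι).PairwiseDisjoint E) (hmeas : ∀ i ∈ I, MeasurableSet (E i))
    (hC : ∀ i ∈ I, E i ⊆ C) (hle : ∀ i ∈ I, μ.real (E i ∩ F i) ≤ μ.real (E i) * p)
    (hA : A ⊆ ⋃ i ∈ I, E i ∩ F i) : μ.real A ≤ μ.real C * p := by
  calc μ.real A ≤ μ.real (⋃ i ∈ I, E i ∩ F i) := 
        measureReal_mono hA (measure_ne_top _ _)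
    _ ≤ ∑ i ∈ I, μ.real (E i ∩ F i) := measureReal_biUnion_finset_le _ _
    _ ≤ ∑ i ∈ I, μ.real (E i) * p := Finset.sum_le_sum hle
    _ = μ.real (⋃ i ∈ I, E i) * p := by
        rw [← Finset.sum_mul, measureReal_biUnion_finset hdisj hmeas]
    _ ≤ μ.real C * p := by
        gcongr
        · exact measure_ne_top _ _
        · exact Set.iUnion₂_subset hC

/-- Breadth-first exploration: each new layer is found through pairs that touch the ball before it.
Pairs touching `T`, the ball of strict radius k, thus fix one layer more than `T` itself, which is
why j = k + 1 is allowed. -/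
theorem ball_congr {ω ω' : Config d} {V T : Set (Fin d → ℤ)} {o : Fin d → ℤ} {k : ℕ}
    (h : ∀ e ∈ pairs V, (∃ x ∈ e, x ∈ T) → ω e = ω' e)
    (hT : {y | (subGraph ω V).edist o y < k} = T) (j : ℕ) (hj : j ≤ k + 1) :
    {y | (subGraph ω V).edist o y < j} = {y | (subGraph ω' V).edist o y < j} := by
  induction j with
  | zero => simp
  | succ j ih =>
    have ih := ih (by omega)
    have key : ∀ z y, (subGraph ω V).edist o z < j →
        ((subGraph ω V).Adj z y ↔ (subGraph ω' V).Adj z y) := by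
      intro z y hz
      have hzT : z ∈ T := hT ▸ hz.trans_le (by exact_mod_cast (by omega : j ≤ k))
      refine and_congr_right fun hz' => and_congr_right fun hy => percGraph_adj_congr ?_
      exact h _ (mk_mem_pairs.2 ⟨hz', hy⟩) ⟨z, by simp, hzT⟩
    ext y
    simp only [Set.mem_ofPred_eq, edist_lt_succ_iff]
    refine or_congr_right (exists_congr fun z => ?_)
    have hz : (subGraph ω V).edist o z < j ↔ (subGraph ω' V).edist o z < j :=
      Set.ext_iff.1 ih z
    constructor
    · rintro ⟨h1, h2⟩
      exact ⟨hz.1 h1, (key z y h1).1 h2⟩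
    · rintro ⟨h1, h2⟩
      exact ⟨hz.2 h1, (key z y (hz.2 h1)).2 h2⟩

theorem mem_of_edist_lt {ω : Config d} {V : Set (Fin d → ℤ)} {o y : Fin d → ℤ} (ho : o ∈ V) {j : ℕ}
    (h : (subGraph ω V).edist o y < j) : y ∈ V := by
  cases j with
  | zero => simp at h
  | succ j =>
    rcases edist_lt_succ_iff.1 h with rfl | ⟨z, _, hz⟩
    · exact ho
    · exact hz.2.1

theorem isLocal_balls {V : Set (Fin d → ℤ)} (hV : V.Finite) (o : Fin d → ℤ) (k : ℕ)
    (T S : Set (Fin d → ℤ)) :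
    IsLocal {ω | {y | (subGraph ω V).edist o y < k} = T ∧
      {y | (subGraph ω V).edist o y < (k + 1 : ℕ)} = S} {e ∈ pairs V | ∃ x ∈ e, x ∈ T} := by
  refine ⟨(finite_pairs hV).subset (Set.sep_subset _ _), fun ω ω' h hω => ?_⟩
  have := ball_congr (fun e he hT => h e ⟨he, hT⟩) hω.1
  exact ⟨(this k (by omega)).symm.trans hω.1, (this (k + 1) le_rfl).symm.trans hω.2⟩

/-- The probability of a geodesic using the edge `s(u, v)` at step `k` is at most the product of
the probabilities of its three parts. -/
theorem measureReal_geodesic_split (q : (Fin d → ℤ) → ℝ≥0∞) (hq : Function.Even q)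
    {V : Set (Fin d → ℤ)} (hV : V.Finite) {o : Fin d → ℤ} (ho : o ∈ V) (x : Fin d → ℤ)
    {u v : Fin d → ℤ} (k l : ℕ) :
    (percMeasure q hq).real {ω | (subGraph ω V).edist o u = k ∧
      ¬ (subGraph ω V).edist o v < (k + 1 : ℕ) ∧ (percGraph ω).Adj u v ∧
      (subGraph ω (V \ {y | (subGraph ω V).edist o y < (k + 1 : ℕ)})).edist v x < l} ≤
    (percMeasure q hq).real {ω | (subGraph ω V).edist o u < (k + 1 : ℕ)} *
      ((percMeasure q hq).real {ω | (percGraph ω).Adj u v} *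
        (percMeasure q hq).real {ω | (subGraph ω V).edist v x < l}) := by
  classical
  set P := percMeasure q hq
  -- The cells fix two consecutive balls T ⊆ S. Only pairs touching T are revealed, and u lies in S
  -- \ T while v lies outside S, so neither s(u, v) nor any pair inside V \ S has been seen.
  let E : Set (Fin d → ℤ) × Set (Fin d → ℤ) → Set (Config d) := fun TS =>
    {ω | {y | (subGraph ω V).edist o y < k} = TS.1 ∧
      {y | (subGraph ω V).edist o y < (k + 1 : ℕ)} = TS.2}
  let F : Set (Fin d → ℤ) × Set (Fin d → ℤ) → Set (Config d) := fun TS =>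
    {ω | (percGraph ω).Adj u v} ∩ {ω | (subGraph ω (V \ TS.2)).edist v x < l}
  have hfin : {TS : Set (Fin d → ℤ) × Set (Fin d → ℤ) | TS.1 ⊆ V ∧ TS.2 ⊆ V ∧ TS.1 ⊆ TS.2 ∧
      u ∉ TS.1 ∧ u ∈ TS.2 ∧ v ∉ TS.2}.Finite :=
    (hV.finite_subsets.prod hV.finite_subsets).subset fun TS h => ⟨h.1, h.2.1⟩
  refine measureReal_le_of_partition hfin.toFinset E F (by positivity) ?_ ?_ ?_ ?_ ?_
  · intro TS _ TS' _ hne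
    refine Set.disjoint_left.2 fun ω h1 h2 => hne ?_
    exact Prod.ext (h1.1.symm.trans h2.1) (h1.2.symm.trans h2.2)
  · exact fun TS _ => (isLocal_balls hV o k TS.1 TS.2).measurableSet
  · intro TS hTS ω hω
    have h2 : u ∈ TS.2 := (hfin.mem_toFinset.1 hTS).2.2.2.2.1
    rw [← hω.2] at h2
    exact h2
  · intro TS hTS
    obtain ⟨hT, hS, hTS', huT, huS, hvS⟩ := hfin.mem_toFinset.1 hTS
    have hloc := isLocal_of_subGraph (hV.subset (Set.sdiff_subset : V \ TS.2 ⊆ V))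
      (fun G => G.edist v x < l)
    have hF := (isLocal_adj u v).measure_inter q hq hloc (by
      refine Set.disjoint_left.2 fun e he he' => ?_
      rw [Set.mem_singleton_iff] at he
      subst he
      exact (mk_mem_pairs.1 he').1.2 huS)
    rw [(isLocal_balls hV o k TS.1 TS.2).measure_inter q hq ((isLocal_adj u v).inter hloc), hF]
    · refine mul_le_mul_of_nonneg_left (mul_le_mul_of_nonneg_left ?_ (by positivity))
        (by positivity)
      -- Allowing the explored sites again only shortens distances, and removes the dependence on
      -- the cell.
      exact measureReal_mono fun ω hω =>
        lt_of_le_of_lt (SimpleGraph.edist_anti (subGraph_mono Set.sdiff_subset)) hω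
    · refine Set.disjoint_left.2 ?_
      rintro e ⟨he, z, hze, hz⟩ (he' | he')
      · rw [Set.mem_singleton_iff] at he'
        subst he'
        rcases Sym2.mem_iff.1 hze with rfl | rfl
        · exact huT hz
        · exact hvS (hTS' hz)
      · exact (he' z hze).2 (hTS' hz)
  · rintro ω ⟨h1, h2, h3, h4⟩
    refine Set.mem_biUnion (x := (⟨{y | (subGraph ω V).edist o y < k},
      {y | (subGraph ω V).edist o y < (k + 1 : ℕ)}⟩ : Set (Fin d → ℤ) × Set (Fin d → ℤ))) ?_
      ⟨⟨rfl, rfl⟩, h3, h4⟩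
    refine hfin.mem_toFinset.2 ⟨fun y hy => mem_of_edist_lt ho hy, fun y hy => mem_of_edist_lt ho hy,
      fun y hy => lt_of_lt_of_le (b := (k : ℕ∞)) hy (Nat.cast_le.2 k.le_succ), ?_, ?_, h2⟩
    · rw [Set.mem_ofPred_eq, h1]; exact lt_irrefl _
    · rw [Set.mem_ofPred_eq, h1]; exact_mod_cast Nat.lt_succ_self k

/-! ### Connection probabilities and expected volumes of balls -/

theorem one_le_norm {x : Fin d → ℤ} (hx : x ≠ 0) : 1 ≤ ‖x‖ := by
  obtain ⟨i, hi⟩ := Function.ne_iff.1 hx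
  refine le_trans ?_ (norm_le_pi_norm x i)
  rw [Int.norm_eq_abs]
  exact_mod_cast Int.one_le_abs hi

/-- The sums `∑ ‖x - o‖ ^ (-p)` over finite sets of sites are bounded if `p > d`. -/
theorem exists_sum_norm_rpow_le (hd : 0 < d) {p : ℝ} (hp : (d : ℝ) < p) :
    ∃ Z : ℝ, 0 ≤ Z ∧ ∀ (V : Finset (Fin d → ℤ)) (o : Fin d → ℤ),
      ∑ x ∈ V.erase o, ‖o - x‖ ^ (-p) ≤ Z := by
  classical
  have hd' : (0 : ℝ) < d := by exact_mod_cast hd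
  -- Since 1 + ‖x‖ ≥ 1 + |x i| for each i, the power (1 + ‖x‖)^(-p) is at most a product of d
  -- one-dimensional powers with exponent -p/d < -1, and the sum factorizes.
  set b : ℝ := p / d with hb
  have hb1 : 1 < b := (one_lt_div hd').2 hp
  set f : ℤ → ℝ := fun n => (1 + |(n : ℝ)|) ^ (-b) with hf
  have hf0 : ∀ n, 0 ≤ f n := fun n => by positivity
  have hsum : Summable f := by
    have h1 : Summable fun n : ℤ => |(n : ℝ)| ^ (-b) := Real.summable_abs_int_rpow hb1
    refine Summable.of_norm_bounded_eventually h1 ?_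
    have : ∀ᶠ n : ℤ in cofinite, n ≠ 0 := eventually_cofinite_ne 0
    filter_upwards [this] with n hn
    rw [Real.norm_of_nonneg (hf0 n)]
    exact Real.rpow_le_rpow_of_nonpos (by positivity) (by linarith) (by linarith)
  refine ⟨2 ^ p * (∑' n, f n) ^ d, mul_nonneg (by positivity) (pow_nonneg (tsum_nonneg hf0) d), fun V o => ?_⟩
  have hterm : ∀ x ∈ V.erase o, ‖o - x‖ ^ (-p) ≤ 2 ^ p * ∏ i, f ((o - x) i) := by
    intro x hx
    have h1 : 1 ≤ ‖o - x‖ := one_le_norm (sub_ne_zero.2 (Finset.ne_of_mem_erase hx).symm)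
    have h2 : (1 + ‖o - x‖) ^ (-p) ≤ ∏ i, f ((o - x) i) := by
      calc (1 + ‖o - x‖) ^ (-p) = ∏ _i : Fin d, (1 + ‖o - x‖) ^ (-b) := by
            rw [Finset.prod_const, Finset.card_univ, Fintype.card_fin, ← Real.rpow_natCast,
              ← Real.rpow_mul (by positivity)]
            congr 1
            rw [hb]; field_simp
        _ ≤ ∏ i, f ((o - x) i) := by
            refine Finset.prod_le_prod (fun _ _ => by positivity) fun i _ => ?_
            refine Real.rpow_le_rpow_of_nonpos (by positivity) ?_ (by linarith)
            have := norm_le_pi_norm (o - x) i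
            rw [Int.norm_eq_abs] at this
            linarith
    calc ‖o - x‖ ^ (-p) = 2 ^ p * (2 * ‖o - x‖) ^ (-p) := by
          rw [Real.mul_rpow (by norm_num) (by positivity), ← mul_assoc,
            ← Real.rpow_add (by norm_num)]
          simp
      _ ≤ 2 ^ p * (1 + ‖o - x‖) ^ (-p) := by
          gcongr 2 ^ p * ?_
          exact Real.rpow_le_rpow_of_nonpos (by positivity) (by linarith) (by linarith)
      _ ≤ _ := by gcongr
  refine (Finset.sum_le_sum hterm).trans ?_
  rw [← Finset.mul_sum]
  refine mul_le_mul_of_nonneg_left ?_ (by positivity)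
  let W : Fin d → Finset ℤ := fun i => (V.erase o).image fun x => (o - x) i
  have hinj : Set.InjOn (fun x => o - x) (V.erase o : Set (Fin d → ℤ)) :=
    fun x _ y _ h => sub_right_injective h
  calc ∑ x ∈ V.erase o, ∏ i, f ((o - x) i)
      = ∑ z ∈ (V.erase o).image (fun x => o - x), ∏ i, f (z i) := by
        rw [Finset.sum_image hinj]
    _ ≤ ∑ z ∈ Fintype.piFinset W, ∏ i, f (z i) := by
        refine Finset.sum_le_sum_of_subset_of_nonneg ?_ fun z _ _ =>
          Finset.prod_nonneg fun i _ => hf0 _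
        intro z hz
        obtain ⟨x, hx, rfl⟩ := Finset.mem_image.1 hz
        exact Fintype.mem_piFinset.2 fun i => Finset.mem_image_of_mem _ hx
    _ = ∏ i, ∑ n ∈ W i, f n := (Finset.prod_univ_sum W fun _ => f).symm
    _ ≤ ∏ _i : Fin d, ∑' n, f n := Finset.prod_le_prod
        (fun i _ => Finset.sum_nonneg fun n _ => hf0 n)
        fun i _ => hsum.sum_le_tsum _ fun n _ => hf0 n
    _ = _ := by simp

/-- Concavity at the midpoint. The factor 2^(1-a), applied to the two radii left and right of the
long edge, is the source of the exponent Δ in the lower bound. -/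
theorem rpow_add_rpow_le {a x y : ℝ} (ha0 : 0 ≤ a) (ha1 : a ≤ 1) (hx : 0 ≤ x) (hy : 0 ≤ y) :
    x ^ a + y ^ a ≤ 2 ^ (1 - a) * (x + y) ^ a := by
  have h := (Real.concaveOn_rpow ha0 ha1).2 (Set.mem_Ici.2 hx) (Set.mem_Ici.2 hy)
    (by norm_num : (0 : ℝ) ≤ 1 / 2) (by norm_num : (0 : ℝ) ≤ 1 / 2) (by norm_num)
  simp only [smul_eq_mul] at h
  rw [← mul_add, ← mul_add, Real.mul_rpow (by norm_num) (by positivity)] at h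
  have h2 : (2 : ℝ) ^ (1 - a) = 2 * (1 / 2) ^ a := by
    rw [Real.rpow_sub (by norm_num), Real.rpow_one, Real.div_rpow (by norm_num) (by norm_num),
      Real.one_rpow]
    ring
  rw [h2]
  linarith

section

variable {q : (Fin d → ℤ) → ℝ≥0∞} {hq : Function.Even q} {C a : ℝ}

/-- The connection probability at distance less than `j`, in terms of a bound `E` on the products of
the expected volumes of two balls whose radii add up to at most `j`. -/
theorem measureReal_edist_lt_le (ha : 0 < a) (hC : 1 ≤ C)
    (h : ∀ x y, x ≠ y → (edgeProb q hq s(x, y) : ℝ) ≤ C * ‖x - y‖ ^ (-a))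
    (V : Finset (Fin d → ℤ)) (j : ℕ) (Φ : ℕ → ℝ) (E : ℝ) (hE0 : 0 ≤ E)
    (hΦ : ∀ i < j, ∀ o ∈ V,
      ∑ x ∈ V, (percMeasure q hq).real {ω | (subGraph ω V).edist o x < i} ≤ Φ i)
    (hE : ∀ k m, k < m → m < j → Φ (k + 1) * Φ (m - k) ≤ E) {o x : Fin d → ℤ}
    (ho : o ∈ V) (hx : x ∈ V) (hox : o ≠ x) :
    (percMeasure q hq).real {ω | (subGraph ω V).edist o x < j} ≤
      j ^ 2 * (C * j ^ a * ‖o - x‖ ^ (-a) * E) := by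
  classical
  set P := percMeasure q hq
  have hnox : 0 < ‖o - x‖ := norm_pos_iff.2 (sub_ne_zero.2 hox)
  -- The last part of the geodesic is read backwards, so that summing over v gives the expected
  -- volume of a ball around x.
  have hsymm : ∀ (v : Fin d → ℤ) (l : ℕ), {ω : Config d | (subGraph ω V).edist v x < l} =
      {ω | (subGraph ω V).edist x v < l} := fun v l => by simp only [SimpleGraph.edist_comm]
  let A : ℕ → ℕ → (Fin d → ℤ) → (Fin d → ℤ) → Set (Config d) := fun m k u v =>
    {ω | (subGraph ω V).edist o u = k ∧
      ¬ (subGraph ω V).edist o v < (k + 1 : ℕ) ∧ (percGraph ω).Adj u v ∧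
      (subGraph ω (V \ {y | (subGraph ω V).edist o y < (k + 1 : ℕ)})).edist v x < (m - k : ℕ)}
  have hsub : {ω : Config d | (subGraph ω V).edist o x < j} ⊆
      ⋃ m ∈ Finset.range j, ⋃ k ∈ Finset.range m, ⋃ u ∈ V,
        ⋃ v ∈ V.filter (fun v => ‖o - x‖ ≤ m * ‖u - v‖), A m k u v := by
    intro ω hω
    obtain ⟨m, hm⟩ := ENat.ne_top_iff_exists.1 (ne_top_of_lt hω)
    obtain ⟨k, hk, u, hu, v, hv, h1, h2, h3, h4, h5⟩ := exists_long_edge hox hm.symm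
    have hmj : m < j := by
      have : (m : ℕ∞) < j := hm ▸ hω
      exact_mod_cast this
    simp only [Set.mem_iUnion, Finset.mem_range, Finset.mem_filter]
    exact ⟨m, hmj, k, hk, u, hu, v, ⟨hv, h3⟩, h1, h2, h4, h5⟩
  have hterm : ∀ m < j, ∀ k < m, ∑ u ∈ V, ∑ v ∈ V.filter (fun v => ‖o - x‖ ≤ m * ‖u - v‖),
      P.real (A m k u v) ≤ C * j ^ a * ‖o - x‖ ^ (-a) * E := by
    intro m hm k hk
    have hm0 : (0 : ℝ) < m := by exact_mod_cast (by omega : 0 < m)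
    set c := C * j ^ a * ‖o - x‖ ^ (-a) with hc
    have hc0 : 0 ≤ c := by positivity
    calc ∑ u ∈ V, ∑ v ∈ V.filter (fun v => ‖o - x‖ ≤ m * ‖u - v‖), P.real (A m k u v)
        ≤ ∑ u ∈ V, ∑ v ∈ V.filter (fun v => ‖o - x‖ ≤ m * ‖u - v‖),
          P.real {ω | (subGraph ω V).edist o u < (k + 1 : ℕ)} *
            (c * P.real {ω | (subGraph ω V).edist x v < (m - k : ℕ)}) := by
          refine Finset.sum_le_sum fun u _ => Finset.sum_le_sum fun v hv => ?_
          have hv := (Finset.mem_filter.1 hv).2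
          have huv : 0 < ‖u - v‖ := by
            by_contra hcon
            nlinarith
          refine (measureReal_geodesic_split q hq V.finite_toSet ho x k (m - k)).trans ?_
          rw [hsymm]
          gcongr
          refine (measureReal_adj_le ha hC h (sub_ne_zero.1 (norm_pos_iff.1 huv))).trans ?_
          -- The long edge satisfies ‖o - x‖ ≤ m ‖u - v‖ with m < j, so ‖u - v‖^(-a) ≤ j^a ‖o -
          -- x‖^(-a).
          rw [hc, mul_assoc]
          refine mul_le_mul_of_nonneg_left ?_ (by positivity)
          rw [Real.rpow_neg huv.le, Real.rpow_neg hnox.le, ← div_eq_mul_inv, ← one_div,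
            div_le_div_iff₀ (by positivity) (by positivity), one_mul,
            ← Real.mul_rpow (by positivity) huv.le]
          refine Real.rpow_le_rpow hnox.le (hv.trans ?_) ha.le
          gcongr
      _ ≤ ∑ u ∈ V, ∑ v ∈ V, P.real {ω | (subGraph ω V).edist o u < (k + 1 : ℕ)} *
            (c * P.real {ω | (subGraph ω V).edist x v < (m - k : ℕ)}) := by
          refine Finset.sum_le_sum fun u _ => Finset.sum_le_sum_of_subset_of_nonneg
            (Finset.filter_subset _ _) fun _ _ _ => by positivity
      _ = c * ((∑ u ∈ V, P.real {ω | (subGraph ω V).edist o u < (k + 1 : ℕ)}) *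
            ∑ v ∈ V, P.real {ω | (subGraph ω V).edist x v < (m - k : ℕ)}) := by
          rw [Finset.sum_mul_sum, Finset.mul_sum]
          refine Finset.sum_congr rfl fun u _ => ?_
          rw [Finset.mul_sum]
          exact Finset.sum_congr rfl fun v _ => by ring
      _ ≤ c * (Φ (k + 1) * Φ (m - k)) := by
          have h1 := hΦ (k + 1) (by omega) o ho
          have h2 := hΦ (m - k) (by omega) x hx
          refine mul_le_mul_of_nonneg_left (mul_le_mul h1 h2 ?_ (le_trans ?_ h1)) hc0 <;>
          exact Finset.sum_nonneg fun _ _ => by positivity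
      _ ≤ c * E := by gcongr; exact hE k m hk hm
  calc P.real {ω | (subGraph ω V).edist o x < j}
      ≤ ∑ m ∈ Finset.range j, ∑ k ∈ Finset.range m, ∑ u ∈ V,
          ∑ v ∈ V.filter (fun v => ‖o - x‖ ≤ m * ‖u - v‖), P.real (A m k u v) := by
        refine (measureReal_mono hsub (measure_ne_top _ _)).trans ?_
        refine (measureReal_biUnion_finset_le _ _).trans (Finset.sum_le_sum fun m _ => ?_)
        refine (measureReal_biUnion_finset_le _ _).trans (Finset.sum_le_sum fun k _ => ?_)
        refine (measureReal_biUnion_finset_le _ _).trans (Finset.sum_le_sum fun u _ => ?_)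
        exact measureReal_biUnion_finset_le _ _
    _ ≤ ∑ m ∈ Finset.range j, m * (C * j ^ a * ‖o - x‖ ^ (-a) * E) := by
        refine Finset.sum_le_sum fun m hm => ?_
        refine (Finset.sum_le_sum fun k hk => hterm m (Finset.mem_range.1 hm) k
          (Finset.mem_range.1 hk)).trans ?_
        simp
    _ ≤ j ^ 2 * (C * j ^ a * ‖o - x‖ ^ (-a) * E) := by
        calc _ ≤ ∑ m ∈ Finset.range j, (j : ℝ) * (C * j ^ a * ‖o - x‖ ^ (-a) * E) := by
              refine Finset.sum_le_sum fun m hm => mul_le_mul_of_nonneg_right ?_ (by positivity)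
              exact_mod_cast (Finset.mem_range.1 hm).le
          _ = _ := by simp; ring

/-- The expected volume of balls grows at most like a stretched exponential. -/
theorem exists_sum_measureReal_le (hd : 0 < d) (hC : 1 ≤ C) (had : (d : ℝ) < a)
    (h : ∀ x y, x ≠ y → (edgeProb q hq s(x, y) : ℝ) ≤ C * ‖x - y‖ ^ (-a)) {α : ℝ} (hα0 : 0 < α)
    (hα1 : α ≤ 1) (hα : 2 ^ (1 - α) * d < a) :
    ∃ A : ℝ, 0 ≤ A ∧ ∀ (j : ℕ) (V : Finset (Fin d → ℤ)), ∀ o ∈ V,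
      ∑ x ∈ V, (percMeasure q hq).real {ω | (subGraph ω V).edist o x < j} ≤
        Real.exp (A * (j : ℝ) ^ α) := by
  classical
  have hd' : (0 : ℝ) < d := by exact_mod_cast hd
  have ha : 0 < a := hd'.trans had
  have htwo : (1 : ℝ) ≤ 2 ^ (1 - α) := Real.one_le_rpow (by norm_num) (by linarith)
  -- The lower limit makes ‖x‖^(-aβ) summable over the lattice; the upper limit gives θ = β 2^(1-α)
  -- < 1, the contraction that closes the induction. Such β exists exactly because 2^(1-α) d < a.
  obtain ⟨β, hβ1, hβ2⟩ : ∃ β, d / a < β ∧ β < 1 / 2 ^ (1 - α) := by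
    refine exists_between ?_
    rw [div_lt_div_iff₀ ha (by positivity)]
    linarith
  have hβ0 : 0 < β := lt_trans (by positivity) hβ1
  have hβle : β ≤ 1 := hβ2.le.trans (by rw [div_le_one (by positivity)]; exact htwo)
  obtain ⟨Z, hZ0, hZ⟩ := exists_sum_norm_rpow_le hd (p := a * β) (by
    rw [div_lt_iff₀ ha] at hβ1; linarith)
  set θ := β * 2 ^ (1 - α) with hθ
  have hθ1 : θ < 1 := by rwa [lt_div_iff₀ (by positivity)] at hβ2
  -- Chosen so that A(1 - θ) j^α pays for the constants and for the power j^(2+a), through log j ≤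
  -- j^α / α.
  set A := (Real.log ((1 + Z) * C) + (2 + a) / α) / (1 - θ) with hA
  have hlog0 : 0 ≤ Real.log ((1 + Z) * C) := Real.log_nonneg (by nlinarith)
  have hA0 : 0 ≤ A := div_nonneg (by positivity) (by linarith)
  refine ⟨A, hA0, fun j V => ?_⟩
  induction j using Nat.strong_induction_on with | _ j ih =>
  intro o ho
  rcases Nat.eq_zero_or_pos j with rfl | hj
  · simp only [CharP.cast_eq_zero, not_lt_zero, Set.ofPred_false, measureReal_empty,
      Finset.sum_const_zero]
    positivity
  have hj1 : (1 : ℝ) ≤ j := by exact_mod_cast hj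
  set B := A * (2 ^ (1 - α) * (j : ℝ) ^ α) with hB
  have hB0 : 0 ≤ B := by positivity
  set Q := j ^ 2 * (C * j ^ a * Real.exp B) with hQ
  have hja : (1 : ℝ) ≤ (j : ℝ) ^ a := Real.one_le_rpow hj1 ha.le
  have hpt : ∀ x ∈ V.erase o, (percMeasure q hq).real {ω | (subGraph ω V).edist o x < j} ≤
      Q ^ β * ‖o - x‖ ^ (-(a * β)) := by
    intro x hx
    have hox : o ≠ x := (Finset.ne_of_mem_erase hx).symm
    have hb := measureReal_edist_lt_le (C := C) ha hC h V j (fun i => Real.exp (A * (i : ℝ) ^ α))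
      (Real.exp B) (Real.exp_nonneg _) (fun i hi o ho => ih i hi o ho) (fun k m hk hm => by
        rw [← Real.exp_add, ← mul_add]
        refine Real.exp_le_exp.2 (mul_le_mul_of_nonneg_left ?_ hA0)
        refine (rpow_add_rpow_le hα0.le hα1 (by positivity) (by positivity)).trans ?_
        refine mul_le_mul_of_nonneg_left (Real.rpow_le_rpow (by positivity) ?_ hα0.le)
          (by positivity)
        exact_mod_cast (by omega : k + 1 + (m - k) ≤ j)) ho (Finset.mem_of_mem_erase hx) hox
    set p := (percMeasure q hq).real {ω | (subGraph ω V).edist o x < j} with hp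
    have hp0 : 0 ≤ p := measureReal_nonneg
    have hp1 : p ≤ 1 := measureReal_le_one
    have hpQ : p ≤ Q * ‖o - x‖ ^ (-a) := hb.trans_eq (by rw [hQ]; ring)
    -- A probability is at most its β-th power. This interpolation with the trivial bound 1 trades
    -- spatial decay for a smaller factor in the exponent.
    calc p ≤ p ^ β := by
          rcases hp0.eq_or_lt with h0 | h0
          · rw [← h0, Real.zero_rpow hβ0.ne']
          · simpa using Real.rpow_le_rpow_of_exponent_ge h0 hp1 hβle
      _ ≤ (Q * ‖o - x‖ ^ (-a)) ^ β := Real.rpow_le_rpow hp0 hpQ hβ0.le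
      _ = _ := by
          rw [Real.mul_rpow (by positivity) (by positivity), ← Real.rpow_mul (norm_nonneg _),
            neg_mul]
  have hQβ : Q ^ β ≤ C * j ^ (2 + a) * Real.exp (A * θ * (j : ℝ) ^ α) := by
    have h1 : Q = (C * j ^ (2 + a)) * Real.exp B := by
      rw [hQ, Real.rpow_add (by positivity)]; norm_cast; ring
    have h2 : 1 ≤ C * (j : ℝ) ^ (2 + a) :=
      one_le_mul_of_one_le_of_one_le hC (Real.one_le_rpow hj1 (by positivity))
    rw [h1, Real.mul_rpow (by positivity) (by positivity), ← Real.exp_mul]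
    refine mul_le_mul ?_ (Real.exp_le_exp.2 (le_of_eq ?_)) (by positivity) (by positivity)
    · simpa using Real.rpow_le_rpow_of_exponent_le h2 hβle
    · rw [hB, hθ]; ring
  have hexp1 : 1 ≤ C * j ^ (2 + a) * Real.exp (A * θ * (j : ℝ) ^ α) := by
    refine one_le_mul_of_one_le_of_one_le (one_le_mul_of_one_le_of_one_le hC
      (Real.one_le_rpow hj1 (by positivity))) (Real.one_le_exp (by positivity))
  calc ∑ x ∈ V, (percMeasure q hq).real {ω | (subGraph ω V).edist o x < j}
      = (percMeasure q hq).real {ω | (subGraph ω V).edist o o < j} +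
        ∑ x ∈ V.erase o, (percMeasure q hq).real {ω | (subGraph ω V).edist o x < j} :=
        (Finset.add_sum_erase _ _ ho).symm
    _ ≤ 1 + ∑ x ∈ V.erase o, Q ^ β * ‖o - x‖ ^ (-(a * β)) :=
        add_le_add measureReal_le_one (Finset.sum_le_sum hpt)
    _ ≤ 1 + Q ^ β * Z := by
        rw [← Finset.mul_sum]; gcongr; exact hZ V o
    _ ≤ (1 + Z) * (C * j ^ (2 + a) * Real.exp (A * θ * (j : ℝ) ^ α)) := by nlinarith
    _ = Real.exp (Real.log ((1 + Z) * C) + (2 + a) * Real.log j + A * θ * (j : ℝ) ^ α) := by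
        rw [Real.exp_add, Real.exp_add, Real.exp_log (by positivity), mul_comm (2 + a) (Real.log _),
          ← Real.rpow_def_of_pos (by positivity)]
        ring
    _ ≤ Real.exp (A * (j : ℝ) ^ α) := by
        refine Real.exp_le_exp.2 ?_
        have h1 : Real.log j ≤ (j : ℝ) ^ α / α := Real.log_le_rpow_div (by positivity) hα0
        have h2 : 1 ≤ (j : ℝ) ^ α := Real.one_le_rpow hj1 hα0.le
        have h3 : A * (1 - θ) = Real.log ((1 + Z) * C) + (2 + a) / α := by
          rw [hA]; field_simp [(by linarith : (1 - θ) ≠ 0)]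
        have h4 : (2 + a) * Real.log j ≤ (2 + a) / α * (j : ℝ) ^ α := by
          calc _ ≤ (2 + a) * ((j : ℝ) ^ α / α) := by gcongr
            _ = _ := by ring
        nlinarith

end

/-! ### Cubes and the box -/

/-- The cube `w + [0, N]^d`. -/
def cube (w : Fin d → ℤ) (N : ℕ) : Finset (Fin d → ℤ) := Finset.Icc w fun i => w i + N

theorem mem_cube {w x : Fin d → ℤ} {N : ℕ} : x ∈ cube w N ↔ ∀ i, w i ≤ x i ∧ x i ≤ w i + N := by
  simp [cube, Pi.le_def, forall_and]

theorem card_cube (w : Fin d → ℤ) (N : ℕ) : (cube w N).card = (N + 1) ^ d := by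
  have : ∀ i : Fin d, (w i + N + 1 - w i).toNat = N + 1 := fun i => by omega
  simp [cube, Pi.card_Icc, this]

theorem box_eq_cube (L : ℕ) : box d L = (cube (fun _ : Fin d => -(L : ℤ)) (2 * L) : Set _) := by
  ext x
  simp only [box, Set.mem_ofPred_eq, Finset.mem_coe, mem_cube, abs_le]
  refine forall_congr' fun i => ?_
  push_cast
  constructor <;> rintro ⟨h1, h2⟩ <;> constructor <;> linarith

/-- Bridges the induced graph on a subtype, in which the diameter is stated, and `subGraph`, whose
vertex type stays fixed when the set of sites varies. -/
theorem edist_induce (ω : Config d) (V : Set (Fin d → ℤ)) (x y : V) :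
    ((percGraph ω).induce V).edist x y = (subGraph ω V).edist x y := by
  refine le_antisymm (le_iInf fun p => ?_) (le_iInf fun p => ?_)
  · have : ∀ (x y : Fin d → ℤ) (p : (subGraph ω V).Walk x y) (hx : x ∈ V) (hy : y ∈ V),
        ((percGraph ω).induce V).edist ⟨x, hx⟩ ⟨y, hy⟩ ≤ p.length := by
      intro x y p
      induction p with
      | nil => intro _ _; simp
      | @cons u v w h p ih =>
        intro hu hw
        refine (SimpleGraph.edist_triangle (v := ⟨v, h.2.1⟩)).trans ?_
        rw [SimpleGraph.Walk.length_cons, Nat.cast_succ, add_comm]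
        refine add_le_add (ih h.2.1 hw) ?_
        exact SimpleGraph.edist_le_one_iff_adj_or_eq.2 (Or.inl h.2.2)
    exact this x y p x.2 y.2
  · let f : (percGraph ω).induce V →g subGraph ω V := ⟨Subtype.val, fun {a b} h => ⟨a.2, b.2, h⟩⟩
    refine (SimpleGraph.edist_le (p.map f)).trans ?_
    rw [SimpleGraph.Walk.length_map]

/-! ### The lower bound on the diameter -/

theorem log_two_mul_div_mem {s : ℝ} (hs : s ∈ Set.Ioo (d : ℝ) (2 * d)) :
    0 < (d : ℝ) ∧ 0 < s ∧ 0 < Real.log (2 * d / s) ∧ Real.log (2 * d / s) < Real.log 2 := by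
  have hd : (0 : ℝ) < d := by have := hs.1.trans hs.2; linarith
  have hs0 : 0 < s := hd.trans hs.1
  refine ⟨hd, hs0, Real.log_pos ?_, Real.log_lt_log (by positivity) ?_⟩
  · rw [one_lt_div hs0]; exact hs.2
  · rw [div_lt_iff₀ hs0]; linarith [hs.1]

theorem one_lt_diamExponent {s : ℝ} (hs : s ∈ Set.Ioo (d : ℝ) (2 * d)) : 1 < diamExponent d s := by
  obtain ⟨-, -, h1, h2⟩ := log_two_mul_div_mem hs
  rw [diamExponent, one_lt_div h1]
  exact h2

theorem tendsto_stretched_exp {B c r p K : ℝ} (hc : 0 < c) (hr : r < 1) :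
    Tendsto (fun x : ℝ => K * x ^ p * Real.exp (B * x ^ r - c * x)) atTop (𝓝 0) := by
  have h1 : Tendsto (fun x : ℝ => |K| * (x ^ p * Real.exp (-(c / 2) * x))) atTop (𝓝 0) := by
    simpa using (tendsto_rpow_mul_exp_neg_mul_atTop_nhds_zero p (c / 2) (by linarith)).const_mul |K|
  refine squeeze_zero_norm' ?_ h1
  have h2 : Tendsto (fun x : ℝ => B * x ^ (-(1 - r))) atTop (𝓝 0) := by
    simpa using (tendsto_rpow_neg_atTop (by linarith : 0 < 1 - r)).const_mul B
  filter_upwards [h2.eventually_le_const (by linarith : 0 < c / 2), eventually_gt_atTop 0]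
    with x hx hx0
  rw [norm_mul, norm_mul, Real.norm_eq_abs, mul_assoc, Real.norm_of_nonneg (by positivity),
    Real.norm_of_nonneg (by positivity)]
  gcongr
  have : x ^ r = x ^ (-(1 - r)) * x := by
    rw [← Real.rpow_add_one hx0.ne']; congr 1; ring
  rw [this]
  nlinarith

/-- Two opposite corners suffice: the volume factor is exp(O((log L)^(αθ))) with αθ < 1, which is
beaten by the factor L^(-a) from their distance. -/
theorem tendsto_boxDiam_lt (q : (Fin d → ℤ) → ℝ≥0∞) (hq : Function.Even q) {s : ℝ}
    (hlim : HasDecayExponent q s) (hs : s ∈ Set.Ioo (d : ℝ) (2 * d)) {ε : ℝ} (hε : 0 < ε) :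
    Tendsto (fun L : ℕ => (percMeasure q hq).real {ω | (boxDiam ω L : ℝ≥0∞) <
      ENNReal.ofReal (Real.log L ^ (diamExponent d s - ε))}) atTop (𝓝 0) := by
  obtain ⟨hd, hs0, hlog, hlog2⟩ := log_two_mul_div_mem hs
  have hΔ := one_lt_diamExponent hs
  have hd' : 0 < d := by exact_mod_cast hd
  set Δ := diamExponent d s with hΔdef
  -- The maximum keeps θ positive when ε ≥ Δ, at the cost of a weaker bound on j.
  set θ := max (Δ - ε) (Δ / 2) with hθ
  have hθ0 : 0 < θ := lt_of_lt_of_le (by linarith) (le_max_right _ _)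
  have hθΔ : θ < Δ := max_lt (by linarith) (by linarith)
  obtain ⟨α, hα1, hα2⟩ : ∃ α, 1 / Δ < α ∧ α < min 1 (1 / θ) := by
    refine exists_between (lt_min ?_ ?_)
    · rw [div_lt_one (by linarith)]; exact hΔ
    · exact one_div_lt_one_div_of_lt hθ0 hθΔ
  have hα0 : 0 < α := lt_trans (by positivity) hα1
  have hαle : α ≤ 1 := (hα2.trans_le (min_le_left _ _)).le
  have hαθ : α * θ < 1 := by
    have := hα2.trans_le (min_le_right _ _)
    rwa [lt_div_iff₀ hθ0] at this
  -- This is α > 1/Δ rewritten as 2d/s < 2^α.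
  have hpow : 2 ^ (1 - α) * (d : ℝ) < s := by
    have h1 : 2 * d / s < 2 ^ α := by
      rw [← Real.log_lt_log_iff (by positivity) (by positivity), Real.log_rpow (by norm_num)]
      rw [hΔdef, diamExponent, one_div_div, div_lt_iff₀ (Real.log_pos (by norm_num))] at hα1
      exact hα1
    rw [Real.rpow_sub (by norm_num), Real.rpow_one, div_mul_eq_mul_div,
      div_lt_iff₀ (by positivity)]
    rw [div_lt_iff₀ hs0] at h1
    linarith
  obtain ⟨a, ha1, ha2⟩ := exists_between hpow
  have hone : (1 : ℝ) ≤ 2 ^ (1 - α) := Real.one_le_rpow (by norm_num) (by linarith)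
  have had : (d : ℝ) < a := lt_of_le_of_lt (by nlinarith) ha1
  have ha0 : 0 < a := hd.trans had
  obtain ⟨C, hC, hCle⟩ := exists_edgeProb_le hq hlim ha0 ha2
  obtain ⟨A, hA0, hA⟩ := exists_sum_measureReal_le hd' hC had hCle hα0 hαle ha1
  have hlogt : Tendsto (fun L : ℕ => Real.log L) atTop atTop :=
    Real.tendsto_log_atTop.comp tendsto_natCast_atTop_atTop
  have hlim := (tendsto_stretched_exp (B := A * 2 ^ (1 - α) * 2 ^ α) (p := θ * (2 + a))
    (K := C * 2 ^ (2 + a)) ha0 hαθ).comp hlogt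
  refine squeeze_zero' (Eventually.of_forall fun _ => measureReal_nonneg) ?_ hlim
  filter_upwards [hlogt.eventually_ge_atTop 1, eventually_ge_atTop 1] with L hL hL1
  have hLpos : (0 : ℝ) < L := by exact_mod_cast hL1
  set t := Real.log L ^ (Δ - ε) with ht
  set j := ⌈t⌉₊ with hj
  have hθL : 1 ≤ Real.log L ^ θ := Real.one_le_rpow hL hθ0.le
  have hjle : (j : ℝ) ≤ 2 * Real.log L ^ θ := by
    have h1 : (j : ℝ) < t + 1 := Nat.ceil_lt_add_one (by positivity)
    have h2 : t ≤ Real.log L ^ θ := Real.rpow_le_rpow_of_exponent_le hL (le_max_left _ _)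
    linarith
  set V := cube (fun _ : Fin d => -(L : ℤ)) (2 * L) with hV
  set o : Fin d → ℤ := fun _ => -(L : ℤ) with ho
  set x : Fin d → ℤ := fun _ => (L : ℤ) with hx
  have hoV : o ∈ V := mem_cube.2 fun i => ⟨le_rfl, by simp [ho]⟩
  have hxV : x ∈ V := mem_cube.2 fun i => ⟨by simp only [hx]; omega, by simp only [hx]; push_cast; omega⟩
  have hnorm : (L : ℝ) ≤ ‖o - x‖ := by
    have h1 := norm_le_pi_norm (o - x) ⟨0, hd'⟩
    rw [Int.norm_eq_abs, Pi.sub_apply] at h1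
    refine le_trans ?_ h1
    simp only [ho, hx]
    push_cast
    rw [abs_sub_comm, abs_of_nonneg] <;> linarith
  have hox : o ≠ x := fun h => by rw [h, sub_self, norm_zero] at hnorm; linarith
  have hsub : {ω : Config d | (boxDiam ω L : ℝ≥0∞) < ENNReal.ofReal t} ⊆
      {ω | (subGraph ω V).edist o x < j} := by
    intro ω hω
    have h1 : (subGraph ω V).edist o x ≤ boxDiam ω L := by
      have hbox : box d L = V := box_eq_cube L
      rw [← hbox]
      exact (edist_induce ω (box d L) ⟨o, by rw [hbox]; exact hoV⟩
        ⟨x, by rw [hbox]; exact hxV⟩).symm.le.trans SimpleGraph.edist_le_ediam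
    have h2 : (boxDiam ω L : ℝ≥0∞) < ((j : ℕ∞) : ℝ≥0∞) := lt_of_lt_of_le hω (by
      rw [ENat.toENNReal_coe, ← ENNReal.ofReal_natCast]
      exact ENNReal.ofReal_le_ofReal (Nat.le_ceil t))
    exact h1.trans_lt (ENat.toENNReal_lt.1 h2)
  have hbound := measureReal_edist_lt_le ha0 hC hCle V j (fun i => Real.exp (A * (i : ℝ) ^ α))
    (Real.exp (A * (2 ^ (1 - α) * (j : ℝ) ^ α))) (Real.exp_nonneg _) (fun i _ o ho => hA i V o ho)
    (fun k m hk hm => by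
      rw [← Real.exp_add, ← mul_add]
      refine Real.exp_le_exp.2 (mul_le_mul_of_nonneg_left ?_ hA0)
      refine (rpow_add_rpow_le hα0.le hαle (by positivity) (by positivity)).trans ?_
      refine mul_le_mul_of_nonneg_left (Real.rpow_le_rpow (by positivity) ?_ hα0.le)
        (by positivity)
      exact_mod_cast (by omega : k + 1 + (m - k) ≤ j)) hoV hxV hox
  refine (measureReal_mono hsub).trans (hbound.trans ?_)
  have hlpos : 0 < Real.log L := by linarith
  have e1 : (j : ℝ) ^ 2 * (j : ℝ) ^ a ≤ 2 ^ (2 + a) * Real.log L ^ (θ * (2 + a)) := by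
    have : (j : ℝ) ^ 2 * (j : ℝ) ^ a ≤ (2 * Real.log L ^ θ) ^ 2 * (2 * Real.log L ^ θ) ^ a := by
      gcongr
    refine this.trans_eq ?_
    rw [Real.rpow_mul hlpos.le, ← Real.mul_rpow (by norm_num) (by positivity),
      Real.rpow_add (by positivity)]
    norm_cast
  have e2 : ‖o - x‖ ^ (-a) ≤ Real.exp (-a * Real.log L) := by
    refine (Real.rpow_le_rpow_of_nonpos hLpos hnorm (by linarith)).trans_eq ?_
    rw [Real.rpow_def_of_pos hLpos, mul_comm]
  have e3 : A * (2 ^ (1 - α) * (j : ℝ) ^ α) ≤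
      A * 2 ^ (1 - α) * 2 ^ α * Real.log L ^ (α * θ) := by
    have : (j : ℝ) ^ α ≤ (2 * Real.log L ^ θ) ^ α := by gcongr
    rw [Real.mul_rpow (by norm_num) (by positivity), ← Real.rpow_mul hlpos.le,
      mul_comm θ α] at this
    calc _ ≤ A * (2 ^ (1 - α) * (2 ^ α * Real.log L ^ (α * θ))) := by gcongr
      _ = _ := by ring
  calc (j : ℝ) ^ 2 * (C * j ^ a * ‖o - x‖ ^ (-a) * Real.exp (A * (2 ^ (1 - α) * (j : ℝ) ^ α)))
      = C * ((j : ℝ) ^ 2 * (j : ℝ) ^ a) *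
        (Real.exp (A * (2 ^ (1 - α) * (j : ℝ) ^ α)) * ‖o - x‖ ^ (-a)) := by ring
    _ ≤ C * (2 ^ (2 + a) * Real.log L ^ (θ * (2 + a))) *
        (Real.exp (A * 2 ^ (1 - α) * 2 ^ α * Real.log L ^ (α * θ)) *
          Real.exp (-a * Real.log L)) := by gcongr
    _ = _ := by
        rw [← Real.exp_add, neg_mul, ← sub_eq_add_neg, Function.comp_apply]
        ring

/-! ### Deterministic doubling of graph distances from scale to scale -/

theorem edist_cube_le_sum (ω : Config d) (w : Fin d → ℤ) (N n : ℕ) :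
    ∀ x ∈ cube w N, ∀ y ∈ cube w N, ∑ i, (x i - y i).natAbs ≤ n →
      (subGraph ω (cube w N)).edist x y ≤ n := by
  induction n with
  | zero =>
    intro x _ y _ h
    have : x = y := by
      ext i
      have := (Finset.sum_eq_zero_iff.1 (Nat.le_zero.1 h)) i (Finset.mem_univ i)
      omega
    simp [this]
  | succ n ih =>
    intro x hx y hy h
    by_cases hxy : x = y
    · simp [hxy]
    obtain ⟨i, hi⟩ := Function.ne_iff.1 hxy
    -- One unit step of coordinate i towards y: it stays between x i and y i, hence in the cube.
    obtain ⟨c, hc1, hc2, hc3⟩ : ∃ c : ℤ, |x i - c| = 1 ∧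
        (c - y i).natAbs + 1 ≤ (x i - y i).natAbs ∧
        (w i ≤ c ∧ c ≤ w i + N) := by
      have h1 := mem_cube.1 hx i
      have h2 := mem_cube.1 hy i
      rcases lt_or_gt_of_ne hi with hlt | hlt
      · exact ⟨x i + 1, by simp, by omega, by omega, by omega⟩
      · exact ⟨x i - 1, by simp, by omega, by omega, by omega⟩
    set x' := Function.update x i c with hx'
    have hx'V : x' ∈ cube w N := mem_cube.2 fun j => by
      by_cases hj : j = i
      · subst hj; simpa [hx'] using hc3
      · simpa [hx', hj] using mem_cube.1 hx j
    have hadj : (subGraph ω (cube w N)).Adj x x' := by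
      refine ⟨hx, hx'V, percGraph_adj.2 (Or.inl ?_)⟩
      change ∑ j, |x j - x' j| = 1
      rw [Finset.sum_eq_single i]
      · simpa [hx'] using hc1
      · intro j _ hj; simp [hx', hj]
      · simp
    have hsum : ∑ j, (x' j - y j).natAbs ≤ n := by
      rw [← Finset.add_sum_erase _ _ (Finset.mem_univ i)] at h ⊢
      have : ∑ j ∈ Finset.univ.erase i, (x' j - y j).natAbs =
          ∑ j ∈ Finset.univ.erase i, (x j - y j).natAbs :=
        Finset.sum_congr rfl fun j hj => by simp [hx', Finset.ne_of_mem_erase hj]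
      rw [this]
      have : x' i = c := by simp [hx']
      rw [this]
      omega
    refine (SimpleGraph.edist_triangle (v := x')).trans ?_
    rw [Nat.cast_succ, add_comm]
    exact add_le_add (ih x' hx'V y hy hsum) (SimpleGraph.edist_le_one_iff_adj_or_eq.2 (Or.inl hadj))

/-- Any two points of `H` at distance at most `r` have graph distance at most `t` in `G`. -/
def DistLE (G : SimpleGraph (Fin d → ℤ)) (H : Set (Fin d → ℤ)) (r : ℝ) (t : ℕ) : Prop :=
  ∀ z ∈ H, ∀ z' ∈ H, ‖z - z'‖ ≤ r → G.edist z z' ≤ t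

theorem DistLE.anti {G : SimpleGraph (Fin d → ℤ)} {H : Set (Fin d → ℤ)} {r r' : ℝ} {t : ℕ}
    (h : DistLE G H r t) (hr : r' ≤ r) : DistLE G H r' t :=
  fun z hz z' hz' hzz => h z hz z' hz' (hzz.trans hr)

/-- Nearest-neighbor paths exist in every configuration; they are the starting point of each
hierarchy. -/
theorem distLE_cube (ω : Config d) (w : Fin d → ℤ) (N : ℕ) (r : ℝ) :
    DistLE (subGraph ω (cube w N)) (cube w N) r (d * ⌊r⌋₊) := by
  intro x hx y hy hxy
  refine edist_cube_le_sum ω w N _ x hx y hy ?_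
  calc ∑ i, (x i - y i).natAbs ≤ ∑ _i : Fin d, ⌊r⌋₊ := by
        refine Finset.sum_le_sum fun i _ => Nat.le_floor ?_
        refine le_trans ?_ ((norm_le_pi_norm (x - y) i).trans hxy)
        rw [Pi.sub_apply, Int.norm_eq_abs, ← Int.cast_abs, Int.abs_eq_natAbs]
        simp
    _ = d * ⌊r⌋₊ := by simp

/-- Points of `H` at distance between `m` and `r` have points of `H` within distance `m` of them
that are joined by an edge. -/
def ConnectedAt (ω : Config d) (H : Set (Fin d → ℤ)) (m r : ℝ) : Prop :=
  ∀ z ∈ H, ∀ z' ∈ H, m < ‖z - z'‖ → ‖z - z'‖ ≤ r →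
    ∃ u ∈ H, ∃ u' ∈ H, ‖z - u‖ ≤ m ∧ ‖u' - z'‖ ≤ m ∧ (percGraph ω).Adj u u'

theorem edist_le_of_bridge {G : SimpleGraph (Fin d → ℤ)} {z u u' z' : Fin d → ℤ} {t : ℕ}
    (h1 : G.edist z u ≤ t) (h2 : G.Adj u u') (h3 : G.edist u' z' ≤ t) :
    G.edist z z' ≤ (2 * t + 1 : ℕ) := by
  have h4 : G.edist u u' ≤ 1 := SimpleGraph.edist_le_one_iff_adj_or_eq.2 (Or.inl h2)
  calc G.edist z z' ≤ G.edist z u + G.edist u z' := SimpleGraph.edist_triangle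
    _ ≤ t + (1 + t) := add_le_add h1 (SimpleGraph.edist_triangle.trans (add_le_add h4 h3))
    _ = (2 * t + 1 : ℕ) := by push_cast; ring

theorem DistLE.step {ω : Config d} {V H : Set (Fin d → ℤ)} {m r : ℝ} {t : ℕ} (hHV : H ⊆ V)
    (h : DistLE (subGraph ω V) H m t) (hc : ConnectedAt ω H m r) :
    DistLE (subGraph ω V) H r (2 * t + 1) := by
  intro z hz z' hz' hr
  rcases le_or_gt ‖z - z'‖ m with hm | hm
  · exact (h z hz z' hz' hm).trans (by exact_mod_cast (by omega : t ≤ 2 * t + 1))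
  · obtain ⟨u, hu, u', hu', h1, h2, h3⟩ := hc z hz z' hz' hm hr
    exact edist_le_of_bridge (h z hz u hu h1) ⟨hHV hu, hHV hu', h3⟩ (h u' hu' z' hz' h2)

theorem DistLE.iterate {ω : Config d} {V H : Set (Fin d → ℤ)} {r : ℕ → ℝ} {t : ℕ} (hHV : H ⊆ V)
    (h : DistLE (subGraph ω V) H (r 0) t) (k : ℕ)
    (hc : ∀ i < k, ConnectedAt ω H (r i) (r (i + 1))) :
    DistLE (subGraph ω V) H (r k) (2 ^ k * (t + 1)) := by
  -- The recursion t ↦ 2t + 1 is solved exactly by 2^k (t + 1) - 1.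
  have key : DistLE (subGraph ω V) H (r k) (2 ^ k * (t + 1) - 1) := by
    induction k with
    | zero => simpa using h
    | succ k ih =>
      have := (ih fun i hi => hc i (by omega)).step hHV (hc k (by omega))
      have h1 : 2 * (2 ^ k * (t + 1) - 1) + 1 = 2 ^ (k + 1) * (t + 1) - 1 := by
        have : 0 < 2 ^ k * (t + 1) := by positivity
        have h2 : 2 ^ (k + 1) * (t + 1) = 2 * (2 ^ k * (t + 1)) := by ring
        omega
      rwa [h1] at this
  exact fun z hz z' hz' hr => (key z hz z' hz' hr).trans (by exact_mod_cast Nat.sub_le _ _)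

/-! ### Probability that the hierarchy fails at some scale -/

section

variable {q : (Fin d → ℤ) → ℝ≥0∞} {hq : Function.Even q} {b ρ₀ : ℝ}

theorem isLocal_no_edge (S S' : Finset (Fin d → ℤ)) :
    IsLocal {ω : Config d | ∀ u ∈ S, ∀ u' ∈ S', ω s(u, u') = false}
      {e | ∃ u ∈ S, ∃ u' ∈ S', s(u, u') = e} := by
  refine ⟨((S ×ˢ S').finite_toSet.image fun p => s(p.1, p.2)).subset ?_, fun ω ω' h hω u hu u' hu' =>
    (h _ ⟨u, hu, u', hu', rfl⟩) ▸ hω u hu u' hu'⟩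
  rintro _ ⟨u, hu, u', hu', rfl⟩
  exact ⟨(u, u'), by simp [hu, hu'], rfl⟩

theorem measureReal_no_edge_le (hρ₀ : 0 < ρ₀) (hb : 0 < b)
    (h : ∀ x y, ρ₀ ≤ ‖x - y‖ → 1 - (edgeProb q hq s(x, y) : ℝ) ≤ Real.exp (-‖x - y‖ ^ (-b)))
    (S S' : Finset (Fin d → ℤ)) {r M : ℝ} (hM : 0 ≤ M)
    (hS : ∀ u ∈ S, ∀ u' ∈ S', ρ₀ ≤ ‖u - u'‖ ∧ ‖u - u'‖ ≤ r) (hMS : M ≤ S.card)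
    (hMS' : M ≤ S'.card) :
    (percMeasure q hq).real {ω | ∀ u ∈ S, ∀ u' ∈ S', ω s(u, u') = false} ≤
      Real.exp (-(M ^ 2 * r ^ (-b))) := by
  classical
  set F := (S ×ˢ S').image fun p => s(p.1, p.2) with hF
  have hdisj : ∀ u ∈ S, u ∉ S' := fun u hu hu' => by
    have := (hS u hu u hu').1
    rw [sub_self, norm_zero] at this
    linarith
  -- The positive separation makes `S` and `S'` disjoint, so all their products are distinct
  -- unordered pairs, hence independent.
  have hinj : Set.InjOn (fun p : (Fin d → ℤ) × (Fin d → ℤ) => s(p.1, p.2)) (S ×ˢ S' : Finset _) := by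
    rintro ⟨u, u'⟩ hu ⟨v, v'⟩ hv huv
    simp only [Finset.coe_product, Set.mem_prod, Finset.mem_coe] at hu hv
    rcases Sym2.eq_iff.1 huv with ⟨rfl, rfl⟩ | ⟨rfl, rfl⟩
    · rfl
    · exact absurd hv.2 (hdisj _ hu.1)
  have hcard : F.card = S.card * S'.card := by
    rw [hF, Finset.card_image_of_injOn hinj, Finset.card_product]
  have hset : {ω : Config d | ∀ u ∈ S, ∀ u' ∈ S', ω s(u, u') = false} =
      {ω | ∀ e ∈ F, ω e = false} := by
    ext ω
    simp only [hF, Finset.mem_image, Finset.mem_product, Prod.exists, Set.mem_ofPred_eq]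
    constructor
    · rintro h _ ⟨u, u', ⟨hu, hu'⟩, rfl⟩
      exact h u hu u' hu'
    · exact fun h u hu u' hu' => h _ ⟨u, u', ⟨hu, hu'⟩, rfl⟩
  rw [hset, measure_cylinder_false]
  calc ∏ e ∈ F, (1 - (edgeProb q hq e : ℝ)) ≤ ∏ _e ∈ F, Real.exp (-r ^ (-b)) := by
        refine Finset.prod_le_prod (fun e _ => sub_nonneg.2 (edgeProb q hq e).2.2) fun e he => ?_
        obtain ⟨⟨u, u'⟩, hu, rfl⟩ := Finset.mem_image.1 he
        obtain ⟨hu, hu'⟩ := Finset.mem_product.1 hu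
        obtain ⟨h1, h2⟩ := hS u hu u' hu'
        refine (h u u' h1).trans (Real.exp_le_exp.2 (neg_le_neg ?_))
        exact Real.rpow_le_rpow_of_nonpos (hρ₀.trans_le h1) h2 (by linarith)
    _ = Real.exp (-(F.card * r ^ (-b))) := by
        rw [Finset.prod_const, ← Real.exp_nat_mul, mul_neg]
    _ ≤ Real.exp (-(M ^ 2 * r ^ (-b))) := by
        -- Without pairs the sign of `r` is unknown, but then M = 0 and the bound is trivial.
        rcases F.eq_empty_or_nonempty with hFe | ⟨e, he⟩
        · have h0 : (S.card : ℝ) * S'.card = 0 := by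
            rw [hFe, Finset.card_empty] at hcard; exact_mod_cast hcard.symm
          have h1 : M = 0 := by
            rcases mul_eq_zero.1 h0 with h0 | h0 <;> linarith
          simp [hFe, h1]
        · obtain ⟨⟨u, u'⟩, hu, rfl⟩ := Finset.mem_image.1 he
          obtain ⟨hu, hu'⟩ := Finset.mem_product.1 hu
          have hr : 0 ≤ r := (norm_nonneg _).trans (hS u hu u' hu').2
          refine Real.exp_le_exp.2 (neg_le_neg (mul_le_mul_of_nonneg_right ?_ (by positivity)))
          rw [hcard, sq]
          push_cast
          exact mul_le_mul hMS hMS' hM (by positivity)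

/-- If the random set `H` is dense and is determined by short edges, then it is likely to be
connected at the scale `m`. -/
theorem measureReal_not_connectedAt_le (hρ₀ : 0 < ρ₀) (hb : 0 < b)
    (h : ∀ x y, ρ₀ ≤ ‖x - y‖ → 1 - (edgeProb q hq s(x, y) : ℝ) ≤ Real.exp (-‖x - y‖ ^ (-b)))
    (V : Finset (Fin d → ℤ)) (H : Config d → Set (Fin d → ℤ)) (hHV : ∀ ω, H ω ⊆ V)
    {T : Set (Sym2 (Fin d → ℤ))} (hT : T.Finite) {R : ℝ} (hTR : ∀ x y, s(x, y) ∈ T → ‖x - y‖ ≤ R)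
    (hH : ∀ ω ω' : Config d, (∀ e ∈ T, ω e = ω' e) → H ω = H ω') {m r M : ℝ} (hM : 0 ≤ M)
    (hm : 3 * ρ₀ ≤ m) (hR : 3 * R ≤ m) (hmr : m ≤ r) :
    (percMeasure q hq).real {ω | (∀ z ∈ V, M ≤ ({u ∈ H ω | 3 * ‖z - u‖ ≤ m}.ncard : ℝ)) ∧
      ¬ ConnectedAt ω (H ω) m r} ≤ V.card ^ 2 * Real.exp (-(M ^ 2 * (2 * r) ^ (-b))) := by
  classical
  set P := percMeasure q hq
  let B : Finset (Fin d → ℤ) → (Fin d → ℤ) → Finset (Fin d → ℤ) := fun S z =>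
    S.filter fun u => 3 * ‖z - u‖ ≤ m
  let A : (Fin d → ℤ) × (Fin d → ℤ) → Set (Config d) := fun p =>
    {ω | ∃ S ∈ V.powerset, H ω = S ∧ M ≤ (B S p.1).card ∧ M ≤ (B S p.2).card ∧
      ∀ u ∈ B S p.1, ∀ u' ∈ B S p.2, ω s(u, u') = false}
  let J := (V ×ˢ V).filter fun p => m < ‖p.1 - p.2‖ ∧ ‖p.1 - p.2‖ ≤ r
  -- Points within m/3 of two centers more than m apart are themselves more than m/3 ≥ R apart, too
  -- far for their pair to belong to `T`.
  have hsep : ∀ p ∈ J, ∀ S : Finset (Fin d → ℤ), ∀ u ∈ B S p.1, ∀ u' ∈ B S p.2,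
      m < 3 * ‖u - u'‖ ∧ ‖u - u'‖ ≤ 2 * r := by
    intro p hp S u hu u' hu'
    obtain ⟨-, hp1, hp2⟩ := Finset.mem_filter.1 hp
    have hu := (Finset.mem_filter.1 hu).2
    have hu' := (Finset.mem_filter.1 hu').2
    have h1 : ‖p.1 - p.2‖ ≤ ‖p.1 - u‖ + ‖u - u'‖ + ‖p.2 - u'‖ := by
      rw [norm_sub_rev p.2 u']
      simpa using norm_add₃_le (a := p.1 - u) (b := u - u') (c := u' - p.2)
    have h2 : ‖u - u'‖ ≤ ‖p.1 - u‖ + ‖p.1 - p.2‖ + ‖p.2 - u'‖ := by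
      rw [norm_sub_rev p.1 u]
      simpa using norm_add₃_le (a := u - p.1) (b := p.1 - p.2) (c := p.2 - u')
    exact ⟨by linarith, by linarith [hmr]⟩
  have hsub : {ω | (∀ z ∈ V, M ≤ ({u ∈ H ω | 3 * ‖z - u‖ ≤ m}.ncard : ℝ)) ∧
      ¬ ConnectedAt ω (H ω) m r} ⊆ ⋃ p ∈ J, A p := by
    rintro ω ⟨hdens, hcon⟩
    simp only [ConnectedAt, not_forall] at hcon
    obtain ⟨z, hz, z', hz', h1, h2, h3⟩ := hcon
    have hfin : (H ω).Finite := V.finite_toSet.subset (hHV ω)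
    have hS : H ω = (hfin.toFinset : Set (Fin d → ℤ)) := by simp
    have hcard : ∀ z, ({u ∈ H ω | 3 * ‖z - u‖ ≤ m}.ncard : ℝ) = (B hfin.toFinset z).card := by
      intro z
      rw [← Set.ncard_coe_finset]
      congr 2
      ext u
      simp [B]
    refine Set.mem_biUnion (x := (z, z')) ?_ ⟨hfin.toFinset, ?_, hS, ?_, ?_, ?_⟩
    · exact Finset.mem_filter.2 ⟨Finset.mem_product.2 ⟨hHV ω hz, hHV ω hz'⟩, h1, h2⟩
    · rw [Finset.mem_powerset]
      intro u hu
      exact hHV ω (hfin.mem_toFinset.1 hu)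
    · rw [← hcard]; exact hdens z (hHV ω hz)
    · rw [← hcard]; exact hdens z' (hHV ω hz')
    · intro u hu u' hu'
      obtain ⟨hu, hzu⟩ := Finset.mem_filter.1 hu
      obtain ⟨hu', hzu'⟩ := Finset.mem_filter.1 hu'
      by_contra hne
      have hm0 : 0 ≤ m := by linarith
      refine h3 ⟨u, hfin.mem_toFinset.1 hu, u', hfin.mem_toFinset.1 hu', ?_, ?_,
        percGraph_adj.2 (Or.inr ⟨by simpa using hne, ?_⟩)⟩
      · linarith [norm_nonneg (z - u)]
      · rw [norm_sub_rev]; linarith [norm_nonneg (z' - u')]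
      · rintro rfl
        have : ‖z - z'‖ ≤ ‖z - u‖ + ‖z' - u‖ := by
          rw [norm_sub_rev z' u]; exact norm_sub_le_norm_sub_add_norm_sub _ _ _
        linarith
  have hA : ∀ p ∈ J, P.real (A p) ≤ Real.exp (-(M ^ 2 * (2 * r) ^ (-b))) := by
    intro p hp
    -- The cells are the possible values of `H`. They depend on `T` only, so given a cell the pairs
    -- between the two balls are still fresh.
    have key := measureReal_le_of_partition (μ := P) (A := A p) (C := Set.univ)
      (V.powerset.filter fun S => M ≤ (B S p.1).card ∧ M ≤ (B S p.2).card)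
      (fun S => {ω | H ω = S}) (fun S => {ω | ∀ u ∈ B S p.1, ∀ u' ∈ B S p.2, ω s(u, u') = false})
      (Real.exp_nonneg (-(M ^ 2 * (2 * r) ^ (-b)))) ?_ ?_ ?_ ?_ ?_
    · simpa using key
    · intro S _ S' _ hne
      refine Set.disjoint_left.2 fun ω h1 h2 => hne ?_
      exact Finset.coe_injective ((show H ω = S from h1).symm.trans h2)
    · intro S _
      exact (⟨hT, fun ω ω' he hω => (hH ω ω' he).symm.trans hω⟩ :
        IsLocal {ω | H ω = S} T).measurableSet
    · exact fun _ _ => Set.subset_univ _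
    · intro S hS
      obtain ⟨-, hS1, hS2⟩ := Finset.mem_filter.1 hS
      rw [IsLocal.measure_inter q hq (⟨hT, fun ω ω' he hω => (hH ω ω' he).symm.trans hω⟩ :
        IsLocal {ω | H ω = S} T) (isLocal_no_edge (B S p.1) (B S p.2))]
      · refine mul_le_mul_of_nonneg_left ?_ measureReal_nonneg
        refine measureReal_no_edge_le hρ₀ hb h _ _ hM (fun u hu u' hu' => ?_) hS1 hS2
        obtain ⟨h1, h2⟩ := hsep p hp S u hu u' hu'
        exact ⟨by linarith, h2⟩
      · refine Set.disjoint_left.2 ?_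
        rintro _ he ⟨u, hu, u', hu', rfl⟩
        have h1 := (hsep p hp S u hu u' hu').1
        have h2 := hTR u u' he
        linarith
    · rintro ω ⟨S, hS, h1, h2, h3, h4⟩
      exact Set.mem_biUnion (x := S) (Finset.mem_filter.2 ⟨hS, h2, h3⟩) ⟨h1, h4⟩
  calc P.real _ ≤ ∑ p ∈ J, P.real (A p) :=
        (measureReal_mono hsub (measure_ne_top _ _)).trans (measureReal_biUnion_finset_le _ _)
    _ ≤ ∑ _p ∈ V ×ˢ V, Real.exp (-(M ^ 2 * (2 * r) ^ (-b))) :=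
        (Finset.sum_le_sum hA).trans (Finset.sum_le_sum_of_subset_of_nonneg
          (Finset.filter_subset _ _) fun _ _ _ => Real.exp_nonneg _)
    _ = _ := by simp [sq]

/-- The hierarchical bound: `k` scales `ρ, ρ ^ g, ρ ^ (g ^ 2), …` cost a factor `2 ^ k`. -/
theorem measureReal_not_distLE_le (hρ₀ : 0 < ρ₀) (hb : 0 < b)
    (h : ∀ x y, ρ₀ ≤ ‖x - y‖ → 1 - (edgeProb q hq s(x, y) : ℝ) ≤ Real.exp (-‖x - y‖ ^ (-b)))
    (V : Finset (Fin d → ℤ)) {N : ℝ} (hV : ∀ x ∈ V, ∀ y ∈ V, ‖x - y‖ ≤ N)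
    (H : Config d → Set (Fin d → ℤ)) (hHV : ∀ ω, H ω ⊆ V)
    {T : Set (Sym2 (Fin d → ℤ))} (hT : T.Finite) {R : ℝ} (hTR : ∀ x y, s(x, y) ∈ T → ‖x - y‖ ≤ R)
    (hH : ∀ ω ω' : Config d, (∀ e ∈ T, ω e = ω' e) → H ω = H ω') {ρ g n : ℝ} (hρ1 : 1 ≤ ρ)
    (hρ : 3 * ρ₀ ≤ ρ) (hR : 3 * R ≤ ρ) (hg : 1 ≤ g) (hκ : 0 ≤ 2 * d - b * g) (hn : 0 < n)
    (k t : ℕ) :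
    (percMeasure q hq).real {ω |
      (∀ z ∈ V, ∀ m, ρ ≤ m → m ≤ N → (m / 6) ^ d / n ≤ ({u ∈ H ω | 3 * ‖z - u‖ ≤ m}.ncard : ℝ)) ∧
      DistLE (subGraph ω V) (H ω) ρ t ∧
      ¬ DistLE (subGraph ω V) (H ω) (ρ ^ g ^ k) (2 ^ k * (t + 1))} ≤
    k * (V.card ^ 2 * Real.exp (-(ρ ^ (2 * d - b * g) / (36 ^ d * 2 ^ b * n ^ 2)))) := by
  classical
  set P := percMeasure q hq
  set r : ℕ → ℝ := fun i => ρ ^ g ^ i with hr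
  have hr0 : r 0 = ρ := by simp [hr]
  have hrs : ∀ i, r (i + 1) = r i ^ g := fun i => by
    simp only [hr]
    rw [← Real.rpow_mul (by linarith), pow_succ]
  have hρr : ∀ i, ρ ≤ r i := fun i => by
    simpa using Real.rpow_le_rpow_of_exponent_le hρ1 (one_le_pow₀ hg : 1 ≤ g ^ i)
  let D : ℕ → Set (Config d) := fun i =>
    {ω | (∀ z ∈ V, (r i / 6) ^ d / n ≤ ({u ∈ H ω | 3 * ‖z - u‖ ≤ r i}.ncard : ℝ)) ∧
      ¬ ConnectedAt ω (H ω) (r i) (r (i + 1))}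
  have hsub : {ω |
      (∀ z ∈ V, ∀ m, ρ ≤ m → m ≤ N → (m / 6) ^ d / n ≤ ({u ∈ H ω | 3 * ‖z - u‖ ≤ m}.ncard : ℝ)) ∧
      DistLE (subGraph ω V) (H ω) ρ t ∧
      ¬ DistLE (subGraph ω V) (H ω) (ρ ^ g ^ k) (2 ^ k * (t + 1))} ⊆ ⋃ i ∈ Finset.range k, D i := by
    rintro ω ⟨hd, hd0, hdk⟩
    by_contra hcon
    simp only [Set.mem_iUnion, Finset.mem_range, not_exists] at hcon
    refine hdk (DistLE.iterate (r := r) (hHV ω) (by rwa [hr0]) k fun i hi => ?_)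
    by_contra hnc
    -- Beyond the diameter of `V` the connection property is vacuous, so density is needed only up
    -- to scale `N`.
    have hlt : r i ≤ N := by
      simp only [ConnectedAt, not_forall] at hnc
      obtain ⟨z, hz, z', hz', h1, -⟩ := hnc
      exact h1.le.trans (hV z (hHV ω hz) z' (hHV ω hz'))
    exact hcon i hi ⟨fun z hz => hd z hz (r i) (hρr i) hlt, hnc⟩
  have hD : ∀ i, P.real (D i) ≤ V.card ^ 2 *
      Real.exp (-(ρ ^ (2 * d - b * g) / (36 ^ d * 2 ^ b * n ^ 2))) := by
    intro i
    have hri := hρr i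
    have hri0 : 0 < r i := by linarith
    refine (measureReal_not_connectedAt_le hρ₀ hb h V H hHV hT hTR hH (by positivity)
      (hρ.trans hri) (hR.trans hri) ?_).trans ?_
    · rw [hrs]
      simpa using Real.rpow_le_rpow_of_exponent_le (hρ1.trans hri) hg
    · gcongr
      rw [hrs, Real.mul_rpow (by norm_num) (by positivity), Real.rpow_neg (by norm_num),
        ← Real.rpow_mul hri0.le]
      -- At scale m there are about m^(2d) / n² pairs of length at most 2 m^g, so the expected
      -- number of open ones is of order m^(2d - bg) / n². As this exponent is nonnegative, the
      -- smallest scale ρ is the worst.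
      have e1 : ((r i / 6) ^ d / n) ^ 2 * ((2 ^ b)⁻¹ * r i ^ (g * -b)) =
          r i ^ (2 * d - b * g) / (36 ^ d * 2 ^ b * n ^ 2) := by
        have : r i ^ (2 * d - b * g) = (r i ^ d) ^ 2 * r i ^ (g * -b) := by
          rw [show (2 * d - b * g : ℝ) = ((d * 2 : ℕ) : ℝ) + g * -b by push_cast; ring,
            Real.rpow_add hri0, Real.rpow_natCast, pow_mul]
        rw [this, div_pow, div_pow, div_pow, ← pow_mul, ← pow_mul, mul_comm d 2, pow_mul 6 2 d,
          show (6 : ℝ) ^ 2 = 36 by norm_num]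
        field_simp
      rw [e1]
      gcongr
  calc P.real _ ≤ ∑ i ∈ Finset.range k, P.real (D i) :=
        (measureReal_mono hsub (measure_ne_top _ _)).trans (measureReal_biUnion_finset_le _ _)
    _ ≤ _ := by
        refine (Finset.sum_le_sum fun i _ => hD i).trans ?_
        simp

end

/-! ### Good cubes and their density -/

theorem norm_sub_le_of_mem_cube {w x y : Fin d → ℤ} {N : ℕ} (hx : x ∈ cube w N)
    (hy : y ∈ cube w N) : ‖x - y‖ ≤ N := by
  refine (pi_norm_le_iff_of_nonneg (Nat.cast_nonneg _)).2 fun i => ?_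
  have h1 := mem_cube.1 hx i
  have h2 := mem_cube.1 hy i
  rw [Pi.sub_apply, Int.norm_eq_abs]
  have : |x i - y i| ≤ N := abs_le.2 ⟨by linarith, by linarith⟩
  exact_mod_cast this

theorem cube_subset_cube {u w : Fin d → ℤ} {l N : ℕ} (h : ∀ i, w i ≤ u i ∧ u i + l ≤ w i + N) :
    cube u l ⊆ cube w N := fun x hx => mem_cube.2 fun i => by
  have h1 := mem_cube.1 hx i
  have h2 := h i
  omega

theorem self_mem_cube (w : Fin d → ℤ) (N : ℕ) : w ∈ cube w N := mem_cube.2 fun i => by simp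

theorem exists_cube_subset {w z : Fin d → ℤ} {N l : ℕ} (hz : z ∈ cube w N) (hl : l ≤ N) :
    ∃ w', cube w' l ⊆ cube w N ∧ ∀ x ∈ cube w' l, ‖z - x‖ ≤ l := by
  -- The corner is clamped to the large cube, so points near its boundary also get a full cube of
  -- side l.
  refine ⟨fun i => max (w i) (z i - l), cube_subset_cube fun i => ?_, fun x hx => ?_⟩
  · have := mem_cube.1 hz i
    omega
  · refine norm_sub_le_of_mem_cube (mem_cube.2 fun i => ?_) hx
    have := mem_cube.1 hz i
    omega

/-- The translate of `u` by `a` in the direction `(1, …, 1)`. -/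
def shift (u : Fin d → ℤ) (a : ℕ) : Fin d → ℤ := fun i => u i + a

/-- The points `u` of `V` such that `u + [0, R]^d` is contained in `V` and has diameter at most
`t`. -/
def goodSet (ω : Config d) (V : Set (Fin d → ℤ)) (R t : ℕ) : Set (Fin d → ℤ) :=
  {u | (cube u R : Set (Fin d → ℤ)) ⊆ V ∧ DistLE (subGraph ω (cube u R)) (cube u R) R t}

theorem goodSet_subset (ω : Config d) (V : Set (Fin d → ℤ)) (R t : ℕ) : goodSet ω V R t ⊆ V :=
  fun u hu => hu.1 (self_mem_cube u R)

theorem distLE_goodSet {ω : Config d} {V : Set (Fin d → ℤ)} {R t : ℕ} {ρ : ℝ}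
    (h : ∀ z z', (cube z R : Set (Fin d → ℤ)) ⊆ V → (cube z' R : Set (Fin d → ℤ)) ⊆ V →
      R < ‖z - z'‖ → ‖z - z'‖ ≤ ρ →
      ∃ u ∈ cube z (R / 3), ∃ u' ∈ cube z' (R / 3), (percGraph ω).Adj u u') :
    DistLE (subGraph ω V) (goodSet ω V R t) ρ (2 * t + 1) := by
  rintro z ⟨hzV, hz⟩ z' ⟨hzV', hz'⟩ hr
  have hin : ∀ v, (cube v R : Set (Fin d → ℤ)) ⊆ V →
      DistLE (subGraph ω (cube v R)) (cube v R) R t →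
      ∀ x ∈ cube v R, ∀ y ∈ cube v R, (subGraph ω V).edist x y ≤ t := fun v hv hd x hx y hy =>
    (SimpleGraph.edist_anti (subGraph_mono hv)).trans (hd x hx y hy (norm_sub_le_of_mem_cube hx hy))
  rcases le_or_gt ‖z - z'‖ R with hR | hR
  · have hpt : ∀ i, |z i - z' i| ≤ R := fun i => by
      have := (norm_le_pi_norm (z - z') i).trans hR
      rw [Pi.sub_apply, Int.norm_eq_abs] at this
      exact_mod_cast this
    -- Cubes with corners at distance at most R share the point `z ⊔ z'`, so two cube diameters
    -- suffice.
    have h1 := hin z hzV hz z (self_mem_cube z R) (z ⊔ z') (mem_cube.2 fun i => by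
      have := abs_le.1 (hpt i)
      rw [Pi.sup_apply]
      omega)
    have h2 := hin z' hzV' hz' (z ⊔ z') (mem_cube.2 fun i => by
      have := abs_le.1 (hpt i)
      rw [Pi.sup_apply]
      omega) z' (self_mem_cube z' R)
    refine (SimpleGraph.edist_triangle.trans (add_le_add h1 h2)).trans ?_
    exact_mod_cast (by omega : t + t ≤ 2 * t + 1)
  · obtain ⟨u, hu, u', hu', hadj⟩ := h z z' hzV hzV' hR hr
    have hsub : ∀ v : Fin d → ℤ, cube v (R / 3) ⊆ cube v R := fun v => cube_subset_cube fun i => by omega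
    exact edist_le_of_bridge (hin z hzV hz z (self_mem_cube z R) u (hsub z hu))
      ⟨hzV (hsub z hu), hzV' (hsub z' hu'), hadj⟩
      (hin z' hzV' hz' u' (hsub z' hu') z' (self_mem_cube z' R))

theorem cube_shift_subset {u : Fin d → ℤ} {R n j : ℕ} (hj : j < n) :
    cube (shift u (j * (R + 1))) R ⊆ cube u (n * (R + 1)) := by
  refine cube_subset_cube fun i => ?_
  have : (j + 1) * (R + 1) ≤ n * (R + 1) := Nat.mul_le_mul_right _ hj
  simp only [shift]
  constructor
  · omega
  · have h2 : ((j + 1) * (R + 1) : ℤ) ≤ n * (R + 1) := by exact_mod_cast this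
    push_cast
    linarith

/-- Pigeonhole: each corner u has a good translate among n, and a good point arises from at most n
corners. The available corners fill a cube with at least m/6 sites per side, because blocks of
length n(R + 1) ≤ m/6 have to fit into a cube of side about m/3. -/
theorem card_goodSet_ge {ω : Config d} {w : Fin d → ℤ} {N R n t : ℕ} (hn : 0 < n)
    (hgood : ∀ u, cube u (n * (R + 1)) ⊆ cube w N →
      ∃ j < n, DistLE (subGraph ω (cube (shift u (j * (R + 1))) R))
        (cube (shift u (j * (R + 1))) R) R t)
    {z : Fin d → ℤ} (hz : z ∈ cube w N) {m : ℝ} (hm : 6 * ((n * (R + 1) : ℕ) : ℝ) ≤ m)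
    (hmN : m ≤ N) :
    (m / 6) ^ d / n ≤ ({u ∈ goodSet ω (cube w N) R t | 3 * ‖z - u‖ ≤ m}.ncard : ℝ) := by
  classical
  set h := n * (R + 1) with hh
  have hm0 : 0 ≤ m := le_trans (by positivity) hm
  set l := ⌊m / 3⌋₊ with hl
  have hlm : (l : ℝ) ≤ m / 3 := Nat.floor_le (by positivity)
  have hlm' : m / 3 < l + 1 := Nat.lt_floor_add_one _
  have hhl : h ≤ l := Nat.le_floor (by linarith)
  have hlN : l ≤ N := by
    have : (l : ℝ) ≤ N := by linarith
    exact_mod_cast this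
  obtain ⟨w', hw'1, hw'2⟩ := exists_cube_subset hz hlN
  have hfin : {u ∈ goodSet ω (cube w N) R t | 3 * ‖z - u‖ ≤ m}.Finite :=
    (cube w N).finite_toSet.subset fun u hu => goodSet_subset _ _ _ _ hu.1
  rw [Set.ncard_eq_toFinset_card _ hfin]
  have hcover : cube w' (l - h) ⊆ (Finset.range n).biUnion fun j =>
      hfin.toFinset.image fun v i => v i - (j * (R + 1) : ℕ) := by
    intro u hu
    have hul : cube u h ⊆ cube w' l := cube_subset_cube fun i => by
      have := mem_cube.1 hu i
      omega
    obtain ⟨j, hj, hd⟩ := hgood u (hul.trans hw'1)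
    have hsub : cube (shift u (j * (R + 1))) R ⊆ cube w' l := (cube_shift_subset hj).trans hul
    refine Finset.mem_biUnion.2 ⟨j, Finset.mem_range.2 hj, Finset.mem_image.2
      ⟨shift u (j * (R + 1)), hfin.mem_toFinset.2 ⟨⟨?_, hd⟩, ?_⟩, ?_⟩⟩
    · exact_mod_cast hsub.trans hw'1
    · have := hw'2 _ (hsub (self_mem_cube _ R))
      linarith
    · ext i; simp [shift]
  have hcard : (l - h + 1) ^ d ≤ n * hfin.toFinset.card := by
    rw [← card_cube w' (l - h)]
    refine (Finset.card_le_card hcover).trans (Finset.card_biUnion_le.trans ?_)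
    refine (Finset.sum_le_sum fun j _ => Finset.card_image_le).trans ?_
    simp
  have hn' : (0 : ℝ) < n := by exact_mod_cast hn
  rw [div_le_iff₀ hn', mul_comm]
  refine le_trans ?_ (by exact_mod_cast hcard : (((l - h + 1 : ℕ) : ℝ)) ^ d ≤ _)
  gcongr
  push_cast [Nat.cast_sub hhl]
  linarith

/-! ### Probability estimates for cubes -/

section

variable {q : (Fin d → ℤ) → ℝ≥0∞} {hq : Function.Even q} {b ρ₀ : ℝ}

/-- The hierarchy on the full cube: the set is deterministic, has density of order one, and starts
from the lattice distance at scale ρ. It serves with a bounded number of levels. -/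
theorem measureReal_not_distLE_cube_le (hρ₀ : 0 < ρ₀) (hb : 0 < b)
    (h : ∀ x y, ρ₀ ≤ ‖x - y‖ → 1 - (edgeProb q hq s(x, y) : ℝ) ≤ Real.exp (-‖x - y‖ ^ (-b)))
    (w : Fin d → ℤ) (N : ℕ) {ρ g : ℝ} (hρ1 : 1 ≤ ρ) (hρ : 3 * ρ₀ ≤ ρ) (hg : 1 ≤ g)
    (hκ : 0 ≤ 2 * d - b * g) (k : ℕ) {r : ℝ} (hr : r ≤ ρ ^ g ^ k) :
    (percMeasure q hq).real {ω | ¬ DistLE (subGraph ω (cube w N)) (cube w N) r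
      (2 ^ k * (d * ⌊ρ⌋₊ + 1))} ≤
    k * ((((N : ℝ) + 1) ^ d) ^ 2 * Real.exp (-(ρ ^ (2 * d - b * g) / (36 ^ d * 2 ^ b)))) := by
  have key := measureReal_not_distLE_le hρ₀ hb h (cube w N) (N := N)
    (fun x hx y hy => norm_sub_le_of_mem_cube hx hy) (fun _ => cube w N) (fun _ => subset_rfl)
    Set.finite_empty (R := 0) (fun x y h => h.elim) (fun _ _ _ => rfl) hρ1 hρ (by linarith) hg hκ
    one_pos k (d * ⌊ρ⌋₊)
  rw [card_cube, one_pow, mul_one] at key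
  push_cast at key
  refine le_trans (measureReal_mono ?_ (measure_ne_top _ _)) key
  intro ω hω
  refine ⟨fun z hz m hm hmN => ?_, distLE_cube ω w N ρ,
    fun hc => hω (hc.anti hr)⟩
  have hm0 : 0 ≤ m := by linarith
  have hlm : (⌊m / 3⌋₊ : ℝ) ≤ m / 3 := Nat.floor_le (by positivity)
  have hlN : ⌊m / 3⌋₊ ≤ N := by
    have : (⌊m / 3⌋₊ : ℝ) ≤ N := by linarith
    exact_mod_cast this
  obtain ⟨w', hw'1, hw'2⟩ := exists_cube_subset hz hlN
  have hfin : {u ∈ (cube w N : Set (Fin d → ℤ)) | 3 * ‖z - u‖ ≤ m}.Finite :=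
    (cube w N).finite_toSet.subset (Set.sep_subset _ _)
  have hsub : (cube w' ⌊m / 3⌋₊ : Set (Fin d → ℤ)) ⊆
      {u ∈ (cube w N : Set (Fin d → ℤ)) | 3 * ‖z - u‖ ≤ m} := fun u hu =>
    ⟨hw'1 hu, by have := hw'2 u hu; linarith⟩
  have hle := Set.ncard_le_ncard hsub hfin
  rw [Set.ncard_coe_finset, card_cube] at hle
  rw [div_one]
  refine le_trans ?_ (by exact_mod_cast hle : (((⌊m / 3⌋₊ + 1 : ℕ) : ℝ)) ^ d ≤ _)
  gcongr
  have := Nat.lt_floor_add_one (m / 3)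
  push_cast
  linarith

/-- Translates by multiples of R + 1 are disjoint cubes, so the events use disjoint sets of pairs
and are independent. -/
theorem measureReal_all_bad_le (hd : 0 < d) {R t : ℕ} {p : ℝ}
    (hp : ∀ v : Fin d → ℤ, (percMeasure q hq).real
      {ω | ¬ DistLE (subGraph ω (cube v R)) (cube v R) R t} ≤ p) (u : Fin d → ℤ) (n : ℕ) :
    (percMeasure q hq).real {ω | ∀ j < n, ¬ DistLE (subGraph ω (cube (shift u (j * (R + 1))) R))
      (cube (shift u (j * (R + 1))) R) R t} ≤ p ^ n := by
  have hp0 : 0 ≤ p := measureReal_nonneg.trans (hp 0)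
  have hloc : ∀ v : Fin d → ℤ, IsLocal {ω : Config d | ¬ DistLE (subGraph ω (cube v R)) (cube v R) R t}
      (pairs (cube v R)) := fun v =>
    isLocal_of_subGraph (cube v R).finite_toSet fun G => ¬ DistLE G (cube v R) R t
  suffices H : ∀ n, IsLocal {ω | ∀ j < n, ¬ DistLE (subGraph ω (cube (shift u (j * (R + 1))) R))
      (cube (shift u (j * (R + 1))) R) R t}
      {e : Sym2 (Fin d → ℤ) | ∃ j < n, e ∈ pairs (cube (shift u (j * (R + 1))) R)} ∧
      (percMeasure q hq).real {ω | ∀ j < n, ¬ DistLE (subGraph ω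
        (cube (shift u (j * (R + 1))) R)) (cube (shift u (j * (R + 1))) R) R t} ≤ p ^ n from
    (H n).2
  intro n
  induction n with
  | zero => exact ⟨⟨by simp, by simp⟩, by simp⟩
  | succ n ih =>
    have hset : {ω : Config d | ∀ j < n + 1, ¬ DistLE (subGraph ω
        (cube (shift u (j * (R + 1))) R)) (cube (shift u (j * (R + 1))) R) R t} =
        {ω | ∀ j < n, ¬ DistLE (subGraph ω (cube (shift u (j * (R + 1))) R))
          (cube (shift u (j * (R + 1))) R) R t} ∩
        {ω | ¬ DistLE (subGraph ω (cube (shift u (n * (R + 1))) R))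
          (cube (shift u (n * (R + 1))) R) R t} := by
      ext ω
      simp only [Set.mem_ofPred_eq, Set.mem_inter_iff, Nat.forall_lt_succ_right]
    have hset' : {e : Sym2 (Fin d → ℤ) | ∃ j < n + 1, e ∈ pairs (cube (shift u (j * (R + 1))) R)} =
        {e : Sym2 (Fin d → ℤ) | ∃ j < n, e ∈ pairs (cube (shift u (j * (R + 1))) R)} ∪
        pairs (cube (shift u (n * (R + 1))) R) := by
      ext e
      simp only [Set.mem_ofPred_eq, Set.mem_union, Nat.exists_lt_succ_right]
    rw [hset, hset']
    refine ⟨ih.1.inter (hloc _), ?_⟩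
    rw [ih.1.measure_inter q hq (hloc _), pow_succ]
    · exact mul_le_mul ih.2 (hp _) measureReal_nonneg (by positivity)
    · refine Set.disjoint_left.2 ?_
      rintro e ⟨j, hj, he⟩ he'
      induction e with | _ x y =>
      have h1 := (mem_cube.1 (mk_mem_pairs.1 he).1 ⟨0, hd⟩).2
      have h2 := (mem_cube.1 (mk_mem_pairs.1 he').1 ⟨0, hd⟩).1
      simp only [shift] at h1 h2
      have h3 : ((j + 1) * (R + 1) : ℤ) ≤ n * (R + 1) := by
        exact_mod_cast Nat.mul_le_mul_right (R + 1) hj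
      push_cast at h1 h2
      linarith

/-- The estimate is uniform over all pairs of cubes, good or not, so no conditioning on goodness is
needed. Subcubes of side R/3 remain at distance at least 2R/3 when the corners are more than R
apart. -/
theorem measureReal_no_bridge_le (hρ₀ : 0 < ρ₀) (hb : 0 < b)
    (h : ∀ x y, ρ₀ ≤ ‖x - y‖ → 1 - (edgeProb q hq s(x, y) : ℝ) ≤ Real.exp (-‖x - y‖ ^ (-b)))
    (V : Finset (Fin d → ℤ)) {R : ℕ} {ρ : ℝ} (hR : 3 * ρ₀ ≤ R) (hρ : R ≤ ρ) :
    (percMeasure q hq).real {ω | ¬ ∀ z z', (cube z R : Set (Fin d → ℤ)) ⊆ V →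
      (cube z' R : Set (Fin d → ℤ)) ⊆ V → R < ‖z - z'‖ → ‖z - z'‖ ≤ ρ →
      ∃ u ∈ cube z (R / 3), ∃ u' ∈ cube z' (R / 3), (percGraph ω).Adj u u'} ≤
    V.card ^ 2 * Real.exp (-((((R : ℝ) / 3) ^ d) ^ 2 * (2 * ρ) ^ (-b))) := by
  classical
  set P := percMeasure q hq
  let J := (V ×ˢ V).filter fun p => R < ‖p.1 - p.2‖ ∧ ‖p.1 - p.2‖ ≤ ρ
  let A : (Fin d → ℤ) × (Fin d → ℤ) → Set (Config d) := fun p =>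
    {ω | ∀ u ∈ cube p.1 (R / 3), ∀ u' ∈ cube p.2 (R / 3), ω s(u, u') = false}
  have hl : ((R / 3 : ℕ) : ℝ) ≤ R / 3 := Nat.cast_div_le
  have hl' : (R : ℝ) / 3 ≤ (R / 3 : ℕ) + 1 := by
    have : R ≤ 3 * (R / 3 + 1) := by omega
    have : (R : ℝ) ≤ 3 * ((R / 3 : ℕ) + 1) := by exact_mod_cast this
    linarith
  have hsep : ∀ p ∈ J, ∀ u ∈ cube p.1 (R / 3), ∀ u' ∈ cube p.2 (R / 3),
      ρ₀ ≤ ‖u - u'‖ ∧ ‖u - u'‖ ≤ 2 * ρ := by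
    intro p hp u hu u' hu'
    obtain ⟨-, hp1, hp2⟩ := Finset.mem_filter.1 hp
    have h1 : ‖(u - u') - (p.1 - p.2)‖ ≤ R / 3 := by
      refine le_trans ((pi_norm_le_iff_of_nonneg (Nat.cast_nonneg (R / 3))).2 fun i => ?_) hl
      have h1 := mem_cube.1 hu i
      have h2 := mem_cube.1 hu' i
      rw [Int.norm_eq_abs, ← Int.cast_abs]
      have : |((u - u') - (p.1 - p.2)) i| ≤ (R / 3 : ℕ) := by
        simp only [Pi.sub_apply]
        exact abs_le.2 ⟨by linarith, by linarith⟩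
      exact (Int.cast_le.2 this).trans_eq (Int.cast_natCast _)
    have h2 := norm_sub_norm_le (u - u') (p.1 - p.2)
    have h3 := norm_sub_norm_le (p.1 - p.2) (u - u')
    rw [norm_sub_rev (p.1 - p.2) (u - u')] at h3
    constructor <;> linarith
  have hsub : {ω | ¬ ∀ z z', (cube z R : Set (Fin d → ℤ)) ⊆ V →
      (cube z' R : Set (Fin d → ℤ)) ⊆ V → R < ‖z - z'‖ → ‖z - z'‖ ≤ ρ →
      ∃ u ∈ cube z (R / 3), ∃ u' ∈ cube z' (R / 3), (percGraph ω).Adj u u'} ⊆ ⋃ p ∈ J, A p := by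
    intro ω hω
    simp only [Set.mem_ofPred_eq, not_forall] at hω
    obtain ⟨z, z', h1, h2, h3, h4, h5⟩ := hω
    have hpJ : (z, z') ∈ J := Finset.mem_filter.2 ⟨Finset.mem_product.2
      ⟨h1 (self_mem_cube z R), h2 (self_mem_cube z' R)⟩, h3, h4⟩
    refine Set.mem_biUnion hpJ fun u hu u' hu' => ?_
    by_contra hne
    refine h5 ⟨u, hu, u', hu', percGraph_adj.2 (Or.inr ⟨by simpa using hne, ?_⟩)⟩
    rintro rfl
    have := (hsep _ hpJ u hu u hu').1
    rw [sub_self, norm_zero] at this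
    linarith
  have hA : ∀ p ∈ J, P.real (A p) ≤
      Real.exp (-((((R : ℝ) / 3) ^ d) ^ 2 * (2 * ρ) ^ (-b))) := by
    intro p hp
    refine measureReal_no_edge_le hρ₀ hb h _ _ (by positivity) (hsep p hp) ?_ ?_ <;>
    · rw [card_cube]
      push_cast
      gcongr
  calc P.real _ ≤ ∑ p ∈ J, P.real (A p) :=
        (measureReal_mono hsub (measure_ne_top _ _)).trans (measureReal_biUnion_finset_le _ _)
    _ ≤ ∑ _p ∈ V ×ˢ V, Real.exp (-((((R : ℝ) / 3) ^ d) ^ 2 * (2 * ρ) ^ (-b))) :=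
        (Finset.sum_le_sum hA).trans (Finset.sum_le_sum_of_subset_of_nonneg
          (Finset.filter_subset _ _) fun _ _ _ => Real.exp_nonneg _)
    _ = _ := by simp [sq]

/-- Goodness is decided by pairs inside cubes of side R, and 3R ≤ ρ, so the hierarchy from scale ρ
on uses fresh edges. The density 1/n costs the factor n² in the exponent. -/
theorem measureReal_not_distLE_goodSet_le (hρ₀ : 0 < ρ₀) (hb : 0 < b)
    (h : ∀ x y, ρ₀ ≤ ‖x - y‖ → 1 - (edgeProb q hq s(x, y) : ℝ) ≤ Real.exp (-‖x - y‖ ^ (-b)))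
    (w : Fin d → ℤ) {N R n : ℕ} (hn : 0 < n) {ρ g : ℝ} (hρ1 : 1 ≤ ρ) (hρ : 3 * ρ₀ ≤ ρ)
    (hh : 6 * ((n * (R + 1) : ℕ) : ℝ) ≤ ρ) (hg : 1 ≤ g) (hκ : 0 ≤ 2 * d - b * g) (k t t' : ℕ) :
    (percMeasure q hq).real {ω | (∀ u, cube u (n * (R + 1)) ⊆ cube w N →
        ∃ j < n, DistLE (subGraph ω (cube (shift u (j * (R + 1))) R))
          (cube (shift u (j * (R + 1))) R) R t) ∧
      DistLE (subGraph ω (cube w N)) (goodSet ω (cube w N) R t) ρ t' ∧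
      ¬ DistLE (subGraph ω (cube w N)) (goodSet ω (cube w N) R t) (ρ ^ g ^ k)
        (2 ^ k * (t' + 1))} ≤
    k * ((((N : ℝ) + 1) ^ d) ^ 2 *
      Real.exp (-(ρ ^ (2 * d - b * g) / (36 ^ d * 2 ^ b * n ^ 2)))) := by
  have hRρ : 3 * (R : ℝ) ≤ ρ := by
    refine le_trans ?_ hh
    have : R ≤ n * (R + 1) := by nlinarith
    have : (R : ℝ) ≤ (n * (R + 1) : ℕ) := by exact_mod_cast this
    have : (0 : ℝ) ≤ R := Nat.cast_nonneg R
    linarith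
  have key := measureReal_not_distLE_le hρ₀ hb h (cube w N) (N := N)
    (fun x hx y hy => norm_sub_le_of_mem_cube hx hy) (fun ω => goodSet ω (cube w N) R t)
    (fun ω => goodSet_subset ω _ R t) (T := ⋃ u ∈ cube w N, pairs (cube u R))
    ((cube w N).finite_toSet.biUnion fun u _ => finite_pairs (cube u R).finite_toSet)
    (R := R) (fun x y hxy => ?_) (fun ω ω' hω => ?_) hρ1 hρ hRρ hg hκ (n := n)
    (by exact_mod_cast hn) k t'
  · rw [card_cube] at key
    push_cast at key
    refine le_trans (measureReal_mono ?_ (measure_ne_top _ _)) key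
    intro ω hω
    refine ⟨fun z hz m hm hmN => ?_, hω.2⟩
    exact card_goodSet_ge hn hω.1 hz (hh.trans hm) hmN
  · simp only [Set.mem_iUnion] at hxy
    obtain ⟨u, -, hu⟩ := hxy
    obtain ⟨hx, hy⟩ := mk_mem_pairs.1 hu
    exact norm_sub_le_of_mem_cube hx hy
  · ext u
    refine and_congr_right fun hu => ?_
    rw [subGraph_congr fun e he => hω e (Set.mem_biUnion (hu (self_mem_cube u R)) he)]

/-- The diameter of a cube, in terms of the diameters of smaller cubes and of the graph distance at
short range. -/
theorem measureReal_diam_le (hd : 0 < d) (hρ₀ : 0 < ρ₀) (hb : 0 < b)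
    (h : ∀ x y, ρ₀ ≤ ‖x - y‖ → 1 - (edgeProb q hq s(x, y) : ℝ) ≤ Real.exp (-‖x - y‖ ^ (-b)))
    (w : Fin d → ℤ) {N R n k t₁ t₂ : ℕ} (hn : 0 < n) (hN : n * (R + 1) ≤ N) {ρ g p p₂ : ℝ}
    (hρ1 : 1 ≤ ρ) (hR : 3 * ρ₀ ≤ R) (hh : 6 * ((n * (R + 1) : ℕ) : ℝ) ≤ ρ) (hg : 1 ≤ g)
    (hκ : 0 ≤ 2 * d - b * g) (hk : N ≤ ρ ^ g ^ k)
    (hp : ∀ v : Fin d → ℤ, (percMeasure q hq).real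
      {ω | ¬ DistLE (subGraph ω (cube v R)) (cube v R) R t₁} ≤ p)
    (hp₂ : (percMeasure q hq).real
      {ω | ¬ DistLE (subGraph ω (cube w N)) (cube w N) ((n * (R + 1) : ℕ) : ℝ) t₂} ≤ p₂) :
    (percMeasure q hq).real {ω | ¬ ∀ x ∈ cube w N, ∀ y ∈ cube w N,
      (subGraph ω (cube w N)).edist x y ≤ (2 * t₂ + 2 ^ k * (2 * t₁ + 2) : ℕ)} ≤
    p₂ + ((N : ℝ) + 1) ^ d * p ^ n +
      (((N : ℝ) + 1) ^ d) ^ 2 * Real.exp (-((((R : ℝ) / 3) ^ d) ^ 2 * (2 * ρ) ^ (-b))) +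
      k * ((((N : ℝ) + 1) ^ d) ^ 2 *
        Real.exp (-(ρ ^ (2 * d - b * g) / (36 ^ d * 2 ^ b * n ^ 2)))) := by
  set P := percMeasure q hq
  have hRρ : (R : ℝ) ≤ ρ := by
    refine le_trans ?_ hh
    have : R ≤ n * (R + 1) := by nlinarith
    have : (R : ℝ) ≤ (n * (R + 1) : ℕ) := by exact_mod_cast this
    linarith [(Nat.cast_nonneg R : (0 : ℝ) ≤ R)]
  let E₁ : Set (Config d) :=
    {ω | ¬ DistLE (subGraph ω (cube w N)) (cube w N) ((n * (R + 1) : ℕ) : ℝ) t₂}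
  let bad : (Fin d → ℤ) → Set (Config d) := fun u =>
    {ω | ∀ j < n, ¬ DistLE (subGraph ω (cube (shift u (j * (R + 1))) R))
      (cube (shift u (j * (R + 1))) R) R t₁}
  let E₂ : Set (Config d) := ⋃ u ∈ cube w N, bad u
  let E₃ : Set (Config d) := {ω | ¬ ∀ z z', (cube z R : Set (Fin d → ℤ)) ⊆ cube w N →
      (cube z' R : Set (Fin d → ℤ)) ⊆ cube w N → R < ‖z - z'‖ → ‖z - z'‖ ≤ ρ →
      ∃ u ∈ cube z (R / 3), ∃ u' ∈ cube z' (R / 3), (percGraph ω).Adj u u'}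
  let E₄ : Set (Config d) := {ω | (∀ u, cube u (n * (R + 1)) ⊆ cube w N →
        ∃ j < n, DistLE (subGraph ω (cube (shift u (j * (R + 1))) R))
          (cube (shift u (j * (R + 1))) R) R t₁) ∧
      DistLE (subGraph ω (cube w N)) (goodSet ω (cube w N) R t₁) ρ (2 * t₁ + 1) ∧
      ¬ DistLE (subGraph ω (cube w N)) (goodSet ω (cube w N) R t₁) (ρ ^ g ^ k)
        (2 ^ k * (2 * t₁ + 1 + 1))}
  have hsub : {ω | ¬ ∀ x ∈ cube w N, ∀ y ∈ cube w N,
      (subGraph ω (cube w N)).edist x y ≤ (2 * t₂ + 2 ^ k * (2 * t₁ + 2) : ℕ)} ⊆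
      E₁ ∪ E₂ ∪ E₃ ∪ E₄ := by
    intro ω hω
    by_contra hcon
    simp only [Set.mem_union, not_or] at hcon
    obtain ⟨⟨⟨h1, h2⟩, h3⟩, h4⟩ := hcon
    have h1 : DistLE (subGraph ω (cube w N)) (cube w N) ((n * (R + 1) : ℕ) : ℝ) t₂ :=
      not_not.1 h1
    have h2 : ∀ u, cube u (n * (R + 1)) ⊆ cube w N →
        ∃ j < n, DistLE (subGraph ω (cube (shift u (j * (R + 1))) R))
          (cube (shift u (j * (R + 1))) R) R t₁ := by
      intro u hu
      by_contra hne
      push Not at hne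
      exact h2 (Set.mem_biUnion (hu (self_mem_cube u _)) hne)
    have h3 := distLE_goodSet (t := t₁) (not_not.1 h3)
    have h4 : DistLE (subGraph ω (cube w N)) (goodSet ω (cube w N) R t₁) (ρ ^ g ^ k)
        (2 ^ k * (2 * t₁ + 1 + 1)) := by
      by_contra hne
      exact h4 ⟨h2, h3, hne⟩
    -- A block of n translates fits into the box near any point, and one of its cubes is good. The
    -- path x, x', y', y then costs t₂ at either end and the hierarchical distance in the middle.
    have hnear : ∀ x ∈ cube w N, ∃ x' ∈ goodSet ω (cube w N) R t₁,
        (subGraph ω (cube w N)).edist x x' ≤ t₂ := by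
      intro x hx
      obtain ⟨w', hw'1, hw'2⟩ := exists_cube_subset hx hN
      obtain ⟨j, hj, hd⟩ := h2 w' hw'1
      have hsub := cube_shift_subset (u := w') (R := R) hj
      refine ⟨_, ⟨by exact_mod_cast hsub.trans hw'1, hd⟩, ?_⟩
      have hmem := hsub (self_mem_cube (shift w' (j * (R + 1))) R)
      exact h1 x hx _ (hw'1 hmem) (hw'2 _ hmem)
    refine hω fun x hx y hy => ?_
    obtain ⟨x', hx', hxx'⟩ := hnear x hx
    obtain ⟨y', hy', hyy'⟩ := hnear y hy
    have h5 := h4 x' hx' y' hy' ((norm_sub_le_of_mem_cube (goodSet_subset _ _ _ _ hx')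
      (goodSet_subset _ _ _ _ hy')).trans hk)
    rw [SimpleGraph.edist_comm] at hyy'
    refine ((SimpleGraph.edist_triangle (v := x')).trans (add_le_add hxx'
      ((SimpleGraph.edist_triangle (v := y')).trans (add_le_add h5 hyy')))).trans ?_
    apply le_of_eq
    push_cast
    ring
  have b2 : P.real E₂ ≤ ((N : ℝ) + 1) ^ d * p ^ n := by
    refine (measureReal_biUnion_finset_le _ _).trans ?_
    refine (Finset.sum_le_sum fun u _ => measureReal_all_bad_le hd hp u n).trans ?_
    simp [card_cube]
  have b3 : P.real E₃ ≤ (((N : ℝ) + 1) ^ d) ^ 2 *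
      Real.exp (-((((R : ℝ) / 3) ^ d) ^ 2 * (2 * ρ) ^ (-b))) := by
    have := measureReal_no_bridge_le hρ₀ hb h (cube w N) hR hRρ
    rw [card_cube] at this
    push_cast at this
    exact this
  have b4 := measureReal_not_distLE_goodSet_le hρ₀ hb h w (N := N) hn hρ1 (hR.trans hRρ) hh hg hκ
    k t₁ (2 * t₁ + 1)
  calc P.real _ ≤ P.real (E₁ ∪ E₂ ∪ E₃ ∪ E₄) := measureReal_mono hsub (measure_ne_top _ _)
    _ ≤ P.real (E₁ ∪ E₂ ∪ E₃) + P.real E₄ := measureReal_union_le _ _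
    _ ≤ P.real (E₁ ∪ E₂) + P.real E₃ + P.real E₄ := by gcongr; exact measureReal_union_le _ _
    _ ≤ P.real E₁ + P.real E₂ + P.real E₃ + P.real E₄ := by
        gcongr; exact measureReal_union_le _ _
    _ ≤ _ := add_le_add (add_le_add (add_le_add hp₂ b2) b3) b4

end

/-! ### Choice of scales and the upper bound on the diameter -/

theorem tendsto_rpow_mul_exp_neg_rpow {c r p K : ℝ} (hc : 0 < c) (hr : 0 < r) :
    Tendsto (fun x : ℝ => K * x ^ p * Real.exp (-(c * x ^ r))) atTop (𝓝 0) := by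
  have h1 := (tendsto_rpow_mul_exp_neg_mul_atTop_nhds_zero (p / r) c hc).comp
    (tendsto_rpow_atTop hr)
  have h2 := h1.const_mul K
  rw [mul_zero] at h2
  refine h2.congr' ?_
  filter_upwards [eventually_gt_atTop 0] with x hx
  rw [Function.comp_apply, ← Real.rpow_mul hx.le, mul_div_cancel₀ _ hr.ne', neg_mul, mul_assoc]

theorem tendsto_rpow_mul_exp_sub_rpow {B c r p K : ℝ} (hc : 0 < c) (hr : 1 < r) (hK : 0 ≤ K) :
    Tendsto (fun x : ℝ => K * x ^ p * Real.exp (B * x - c * x ^ r)) atTop (𝓝 0) := by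
  have h1 := tendsto_rpow_mul_exp_neg_rpow (p := p) (K := K) (by linarith : 0 < c / 2)
    (by linarith : 0 < r)
  have h2 : ∀ᶠ x : ℝ in atTop, 2 * B / c ≤ x ^ (r - 1) :=
    (tendsto_rpow_atTop (by linarith)).eventually_ge_atTop _
  refine squeeze_zero' ?_ ?_ h1
  · filter_upwards [eventually_ge_atTop 0] with x hx
    positivity
  · filter_upwards [h2, eventually_gt_atTop 0] with x hx hx0
    gcongr
    rw [div_le_iff₀ hc] at hx
    have : x ^ r = x ^ (r - 1) * x := by rw [← Real.rpow_add_one hx0.ne']; congr 1; ring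
    rw [this]
    nlinarith

theorem boxDiam_le {ω : Config d} {L : ℕ} {t : ℕ∞}
    (h : ∀ y ∈ cube (fun _ : Fin d => -(L : ℤ)) (2 * L),
      ∀ z ∈ cube (fun _ : Fin d => -(L : ℤ)) (2 * L),
        (subGraph ω (cube (fun _ : Fin d => -(L : ℤ)) (2 * L))).edist y z ≤ t) :
    boxDiam ω L ≤ t := by
  refine SimpleGraph.ediam_le_of_edist_le fun y z => (edist_induce ω _ _ _).trans_le ?_
  have hmem : ∀ y : box d L, (y : Fin d → ℤ) ∈ cube (fun _ : Fin d => -(L : ℤ)) (2 * L) :=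
    fun y => Finset.mem_coe.1 ((Set.ext_iff.1 (box_eq_cube L) _).1 y.2)
  have := h y (hmem y) z (hmem z)
  rwa [← box_eq_cube] at this

/-- With τ = 2 - s/d, concavity of log between 1 and 1/2 gives log(2d/s) ≤ τ log 2, so Δ ≥ 1/τ,
while 2d - s = dτ ≥ τ. Hence a starting scale (log L)^(Δ+ε/2) is large enough for union bounds over
the whole box. -/
theorem one_le_diamExponent_mul {s : ℝ} (hs : s ∈ Set.Ioo (d : ℝ) (2 * d)) :
    1 ≤ diamExponent d s * (2 * d - s) := by
  obtain ⟨hd, hs0, hlog, -⟩ := log_two_mul_div_mem hs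
  have hd1 : (1 : ℝ) ≤ d := by
    have : 0 < d := by exact_mod_cast hd
    exact_mod_cast this
  have hlog2 : 0 < Real.log 2 := Real.log_pos (by norm_num)
  set τ := 2 - s / d with hτ
  have hsd : 1 < s / d := (one_lt_div hd).2 hs.1
  have hsd' : s / d < 2 := by rw [div_lt_iff₀ hd]; exact hs.2
  have hconc := strictConcaveOn_log_Ioi.concaveOn.2 (Set.mem_Ioi.2 one_pos)
    (Set.mem_Ioi.2 one_half_pos) (by linarith : 0 ≤ 1 - τ) (by linarith : 0 ≤ τ) (by ring)
  simp only [smul_eq_mul, Real.log_one, mul_zero, zero_add, one_div, Real.log_inv] at hconc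
  have harg : (1 - τ) * 1 + τ * 2⁻¹ = (2 * d / s)⁻¹ := by
    rw [hτ]; field_simp; ring
  rw [harg, Real.log_inv] at hconc
  have h1 : Real.log (2 * d / s) ≤ τ * Real.log 2 := by linarith
  have h2 : 2 * (d : ℝ) - s = d * τ := by rw [hτ]; field_simp
  rw [diamExponent, h2, div_mul_eq_mul_div, one_le_div hlog]
  nlinarith [mul_nonneg (by linarith : (0 : ℝ) ≤ τ) hlog2.le]

/-- For y = log N, these k levels of exponent g reach size N, and their cost 2^k has exponent log 2
/ log g, close to Δ when g is close to 2d/s. -/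
theorem exists_level_count {g : ℝ} (hg : 1 < g) {y : ℝ} (hy : 1 ≤ y) :
    ∃ k : ℕ, y ≤ g ^ k ∧ (2 : ℝ) ^ k ≤ 2 * y ^ (Real.log 2 / Real.log g) ∧
      (k : ℝ) ≤ y / Real.log g + 1 := by
  have hlg : 0 < Real.log g := Real.log_pos hg
  have hy0 : 0 < y := by linarith
  have hly : 0 ≤ Real.log y := Real.log_nonneg hy
  refine ⟨⌈Real.log y / Real.log g⌉₊, ?_, ?_, ?_⟩
  · have h1 : Real.log y / Real.log g ≤ ⌈Real.log y / Real.log g⌉₊ := Nat.le_ceil _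
    rw [div_le_iff₀ hlg] at h1
    rw [← Real.log_le_log_iff hy0 (by positivity), Real.log_pow]
    exact h1
  · have h1 : (⌈Real.log y / Real.log g⌉₊ : ℝ) ≤ Real.log y / Real.log g + 1 :=
      (Nat.ceil_lt_add_one (by positivity)).le
    rw [← Real.rpow_natCast]
    refine (Real.rpow_le_rpow_of_exponent_le one_le_two h1).trans_eq ?_
    rw [Real.rpow_add_one two_ne_zero, mul_comm, Real.rpow_def_of_pos hy0,
      Real.rpow_def_of_pos two_pos]
    congr 2
    ring
  · refine (Nat.ceil_lt_add_one (by positivity)).le.trans ?_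
    gcongr
    exact Real.log_le_self hy0.le

/-- The parameters of the multiscale construction. -/
theorem exists_scale_params {s : ℝ} (hs : s ∈ Set.Ioo (d : ℝ) (2 * d)) {ε : ℝ} (hε : 0 < ε) :
    ∃ g b g₂ b₂ K : ℝ, 1 < g ∧ s < b ∧ b * g < 2 * d ∧
      Real.log 2 / Real.log g ≤ diamExponent d s + ε / 4 ∧ 1 < g₂ ∧ s < b₂ ∧
      1 < (diamExponent d s + ε / 2) * (2 * d - b₂ * g₂) ∧ 0 < K ∧
      1 < 2 * d * K - b * (K + 4) ∧ 5 < (2 * d - b * g) * (K + 4) := by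
  obtain ⟨hd, hs0, hlog, -⟩ := log_two_mul_div_mem hs
  have hΔ := one_lt_diamExponent hs
  have hΔs := one_le_diamExponent_mul hs
  have hlog2 : 0 < Real.log 2 := Real.log_pos (by norm_num)
  set Δ := diamExponent d s with hΔdef
  -- Here g = e^y is slightly below 2d/s, close enough that log 2 / log g ≤ Δ + ε/4.
  obtain ⟨y, hy1, hy2⟩ : ∃ y, Real.log 2 / (Δ + ε / 4) < y ∧ y < Real.log (2 * d / s) := by
    refine exists_between ?_
    rw [div_lt_iff₀ (by linarith)]
    have : Δ * Real.log (2 * d / s) = Real.log 2 := by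
      rw [hΔdef, diamExponent, div_mul_cancel₀ _ hlog.ne']
    nlinarith
  have hy0 : 0 < y := lt_trans (by positivity) hy1
  have hgs : Real.exp y < 2 * d / s := (Real.lt_log_iff_exp_lt (by positivity)).1 hy2
  have hgpos := Real.exp_pos y
  obtain ⟨b, hb1, hb2⟩ : ∃ b, s < b ∧ b < 2 * d / Real.exp y := by
    refine exists_between ?_
    rw [lt_div_iff₀ hs0] at hgs
    rw [lt_div_iff₀ hgpos]
    linarith
  rw [lt_div_iff₀ hgpos] at hb2
  have hg1 : 1 < Real.exp y := Real.one_lt_exp_iff.2 hy0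
  have hbd : b < 2 * d := by nlinarith
  -- The number v is the product b₂ g₂, slightly larger than s.
  obtain ⟨v, hv1, hv2⟩ : ∃ v, s < v ∧ v < 2 * d - 1 / (Δ + ε / 2) := by
    refine exists_between ?_
    rw [lt_sub_iff_add_lt, ← lt_sub_iff_add_lt', div_lt_iff₀ (by linarith)]
    have : 0 < 2 * d - s := by linarith [hs.2]
    nlinarith
  obtain ⟨g₂, hg₂, hg₂'⟩ : ∃ g₂, 1 < g₂ ∧ g₂ < v / s := exists_between ((one_lt_div hs0).2 hv1)
  have hg₂0 : 0 < g₂ := by linarith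
  refine ⟨Real.exp y, b, g₂, v / g₂, max ((4 * b + 2) / (2 * d - b)) (6 / (2 * d - b * Real.exp y)),
    hg1, hb1, hb2, ?_, hg₂, ?_, ?_, ?_, ?_, ?_⟩
  · rw [Real.log_exp, div_le_iff₀ hy0]
    rw [div_lt_iff₀ (by linarith)] at hy1
    linarith
  · rw [lt_div_iff₀ hs0] at hg₂'
    rw [lt_div_iff₀ hg₂0]
    linarith
  · rw [div_mul_cancel₀ _ hg₂0.ne']
    have h1 : 1 / (Δ + ε / 2) < 2 * d - v := by linarith
    rwa [div_lt_iff₀ (by linarith), mul_comm] at h1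
  · exact lt_of_lt_of_le (div_pos (by linarith) (by linarith)) (le_max_left _ _)
  · have h1 := le_max_left ((4 * b + 2) / (2 * d - b)) (6 / (2 * d - b * Real.exp y))
    rw [div_le_iff₀ (by linarith)] at h1
    linarith
  · have h1 := le_max_right ((4 * b + 2) / (2 * d - b)) (6 / (2 * d - b * Real.exp y))
    rw [div_le_iff₀ (by linarith)] at h1
    linarith

set_option maxHeartbeats 1000000 in
theorem tendsto_lt_boxDiam (q : (Fin d → ℤ) → ℝ≥0∞) (hq : Function.Even q) {s : ℝ}
    (hlim : HasDecayExponent q s) (hs : s ∈ Set.Ioo (d : ℝ) (2 * d)) {ε : ℝ} (hε : 0 < ε) :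
    Tendsto (fun L : ℕ => (percMeasure q hq).real {ω |
      ENNReal.ofReal (Real.log L ^ (diamExponent d s + ε)) < (boxDiam ω L : ℝ≥0∞)}) atTop (𝓝 0) := by
  obtain ⟨hd, hs0, -, -⟩ := log_two_mul_div_mem hs
  have hΔ := one_lt_diamExponent hs
  have hd' : 0 < d := by exact_mod_cast hd
  obtain ⟨g, b, g₂, b₂, K, hg, hsb, hbg, hgΔ, hg₂, hsb₂, hκ₂, hK, hK1, hK2⟩ :=
    exists_scale_params hs hε
  set Δ := diamExponent d s with hΔdef
  have hb : 0 < b := by linarith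
  have hb₂ : 0 < b₂ := by linarith
  obtain ⟨ρ₀, hρ₀, hedge⟩ := exists_one_sub_edgeProb_le hq hd' hs0 hlim hsb
  obtain ⟨ρ₂, hρ₂, hedge₂⟩ := exists_one_sub_edgeProb_le hq hd' hs0 hlim hsb₂
  -- The numbers of levels k₁ and k₂ do not depend on L: raising a power of log L to a larger power
  -- of log L takes boundedly many levels, at a constant cost.
  obtain ⟨k₁, hk₁⟩ := pow_unbounded_of_one_lt ((K + 1) / (ε / 4)) hg
  obtain ⟨k₂, hk₂⟩ := pow_unbounded_of_one_lt ((K + 3) / (Δ + ε / 2)) hg₂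
  rw [div_lt_iff₀ (by linarith)] at hk₁ hk₂
  have hlg : 0 < Real.log g := Real.log_pos hg
  set κ := 2 * d - b * g with hκdef
  have hκ : 0 < κ := by linarith
  set κ₂ := 2 * d - b₂ * g₂ with hκ₂def
  have hκ₂0 : 0 < κ₂ := by
    by_contra hcon
    have : (Δ + ε / 2) * κ₂ ≤ 0 := mul_nonpos_of_nonneg_of_nonpos (by linarith) (not_lt.1 hcon)
    linarith
  set c : ℝ := (36 ^ d * 2 ^ b)⁻¹ with hc
  set c₂ : ℝ := (36 ^ d * 2 ^ b₂)⁻¹ with hc₂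
  have hc0 : 0 < c := by positivity
  have hc₂0 : 0 < c₂ := by positivity
  -- The bound on the probability that a cube of side R is not good. It tends to 0 but may be far
  -- larger than L^(-d), hence the n independent trials.
  let p : ℝ → ℝ := fun x => k₁ * (9 ^ d) * x ^ (2 * d * K) * Real.exp (-(c * x ^ (ε / 4 * κ)))
  -- The summands bound, in order, failure of the local distances, a block without good cube, a
  -- missing bridge, and failure of the hierarchy on the good set.
  let F : ℝ → ℝ := fun x =>
    k₂ * x ^ (0 : ℝ) * Real.exp (4 * d * x - c₂ * x ^ ((Δ + ε / 2) * κ₂)) +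
    1 * x ^ (0 : ℝ) * Real.exp (2 * d * x - 1 * x ^ (2 : ℝ)) +
    1 * x ^ (0 : ℝ) * Real.exp (4 * d * x - (9 ^ d * 2 ^ b)⁻¹ * x ^ (2 * d * K - b * (K + 4))) +
    (2 / Real.log g + 1) * x ^ (1 : ℝ) * Real.exp (4 * d * x - c / 4 * x ^ (κ * (K + 4) - 4))
  have hp : Tendsto p atTop (𝓝 0) := tendsto_rpow_mul_exp_neg_rpow hc0 (by positivity)
  have hF : Tendsto F atTop (𝓝 0) := by
    have := (((tendsto_rpow_mul_exp_sub_rpow (B := 4 * d) (p := 0) hc₂0 hκ₂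
      (Nat.cast_nonneg k₂)).add
      (tendsto_rpow_mul_exp_sub_rpow (B := 2 * d) (p := 0) one_pos one_lt_two zero_le_one)).add
      (tendsto_rpow_mul_exp_sub_rpow (B := 4 * d) (p := 0) (c := (9 ^ d * 2 ^ b)⁻¹)
        (by positivity) hK1 zero_le_one)).add
      (tendsto_rpow_mul_exp_sub_rpow (B := 4 * d) (p := 1) (c := c / 4) (by positivity)
        (by linarith : 1 < κ * (K + 4) - 4) (by positivity : 0 ≤ 2 / Real.log g + 1))
    simpa only [add_zero] using this
  have hlogt : Tendsto (fun L : ℕ => Real.log L) atTop atTop :=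
    Real.tendsto_log_atTop.comp tendsto_natCast_atTop_atTop
  have htop : ∀ {r : ℝ}, 0 < r → ∀ C : ℝ, ∀ᶠ L : ℕ in atTop, C ≤ Real.log L ^ r :=
    fun hr C => hlogt.eventually ((tendsto_rpow_atTop hr).eventually_ge_atTop C)
  have hexp : ∀ᶠ L : ℕ in atTop, 1 * Real.log L ^ (K + 3) * Real.exp (-(1 * Real.log L ^ (1 : ℝ))) ≤ 1 :=
    hlogt.eventually ((tendsto_rpow_mul_exp_neg_rpow one_pos one_pos).eventually_le_const one_pos)
  set D : ℝ := 2 * (2 ^ k₂ * (d + 1)) + 2 * 2 ^ (Δ + ε / 4) * (2 * (2 ^ k₁ * (d + 1)) + 2) with hD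
  refine squeeze_zero' (Eventually.of_forall fun _ => measureReal_nonneg) ?_ (hF.comp hlogt)
  filter_upwards [hlogt.eventually_ge_atTop 6, eventually_ge_atTop 3, hexp,
    hlogt.eventually (hp.eventually_le_const (Real.exp_pos (-1))),
    htop (by linarith : 0 < ε / 4) (3 * ρ₀), htop (by linarith : 0 < Δ + ε / 2) (3 * ρ₂),
    htop hK (3 * ρ₀), htop (by linarith : 0 < ε / 2) D]
    with L hx6 hL3 hexpL hpL hρ1 hρ2 hρK hDL
  have hL0 : (3 : ℝ) ≤ L := by exact_mod_cast hL3
  have hLexp : Real.exp (Real.log L) = L := Real.exp_log (by linarith)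
  have hlog2L : Real.log ((2 * L : ℕ) : ℝ) ≤ 2 * Real.log L := by
    have : Real.log 2 ≤ Real.log L := Real.log_le_log (by norm_num) (by linarith)
    push_cast
    rw [Real.log_mul two_ne_zero (by positivity)]
    linarith
  have hlog2L' : 1 ≤ Real.log ((2 * L : ℕ) : ℝ) := by
    have : Real.log L ≤ Real.log ((2 * L : ℕ) : ℝ) :=
      Real.log_le_log (by linarith) (by push_cast; linarith)
    linarith
  have hN1 : ((2 * L : ℕ) : ℝ) + 1 ≤ Real.exp (2 * Real.log L) := by
    rw [two_mul (Real.log L), Real.exp_add, hLexp]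
    push_cast
    have := mul_le_mul_of_nonneg_right hL0 (Nat.cast_nonneg L)
    linarith
  rw [Function.comp_apply]
  set x := Real.log L with hx
  have hx0 : 0 < x := by linarith
  have hx1 : 1 ≤ x := by linarith
  set R := ⌈x ^ K⌉₊ with hR
  set n := ⌈x ^ (2 : ℝ)⌉₊ with hn
  have hxK : 1 ≤ x ^ K := Real.one_le_rpow hx1 hK.le
  have hx2 : 1 ≤ x ^ (2 : ℝ) := Real.one_le_rpow hx1 (by norm_num)
  have hR1 : x ^ K ≤ R := Nat.le_ceil _
  have hR2 : (R : ℝ) + 1 ≤ 3 * x ^ K := by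
    have := Nat.ceil_lt_add_one (by positivity : 0 ≤ x ^ K)
    rw [← hR] at this
    linarith
  have hn1 : x ^ (2 : ℝ) ≤ n := Nat.le_ceil _
  have hn2 : (n : ℝ) ≤ 2 * x ^ (2 : ℝ) := by
    have := Nat.ceil_lt_add_one (by positivity : 0 ≤ x ^ (2 : ℝ))
    rw [← hn] at this
    linarith
  have hn0 : 0 < n := Nat.ceil_pos.2 (by positivity)
  have hh : ((n * (R + 1) : ℕ) : ℝ) ≤ 6 * x ^ (K + 2) := by
    push_cast
    calc (n : ℝ) * (R + 1) ≤ (2 * x ^ (2 : ℝ)) * (3 * x ^ K) := by gcongr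
      _ = 6 * x ^ (K + 2) := by rw [Real.rpow_add hx0]; ring
  have hh3 : ((n * (R + 1) : ℕ) : ℝ) ≤ x ^ (K + 3) := by
    refine hh.trans ?_
    rw [show K + 3 = K + 2 + 1 by ring, Real.rpow_add_one hx0.ne', mul_comm]
    gcongr
  have hh4 : 6 * ((n * (R + 1) : ℕ) : ℝ) ≤ x ^ (K + 4) := by
    rw [show K + 4 = K + 3 + 1 by ring, Real.rpow_add_one hx0.ne', mul_comm]
    gcongr
  have hhN : n * (R + 1) ≤ 2 * L := by
    have h1 : x ^ (K + 3) ≤ L := by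
      rw [Real.rpow_one, one_mul, one_mul, Real.exp_neg, hLexp, ← div_eq_mul_inv,
        div_le_one (by linarith)] at hexpL
      exact hexpL
    have h2 : ((n * (R + 1) : ℕ) : ℝ) ≤ L := hh3.trans h1
    have h3 : n * (R + 1) ≤ L := by exact_mod_cast h2
    omega
  obtain ⟨k, hk1, hk2, hk3⟩ := exists_level_count hg hlog2L'
  have hkN : ((2 * L : ℕ) : ℝ) ≤ (x ^ (K + 4)) ^ g ^ k := by
    have hpos : (0 : ℝ) < ((2 * L : ℕ) : ℝ) := by push_cast; linarith
    rw [← Real.rpow_mul hx0.le, ← Real.log_le_log_iff hpos (by positivity), Real.log_rpow hx0]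
    have h1 : 1 ≤ Real.log x := by
      rw [Real.le_log_iff_exp_le hx0]
      linarith [Real.exp_one_lt_d9]
    refine hk1.trans ?_
    calc g ^ k = 1 * g ^ k * 1 := by ring
      _ ≤ (K + 4) * g ^ k * Real.log x := by gcongr; linarith
  set ρ1 := x ^ (ε / 4) with hρ1def
  set ρ2 := x ^ (Δ + ε / 2) with hρ2def
  have hρ1' : 1 ≤ ρ1 := by linarith
  have hρ2' : 1 ≤ ρ2 := by linarith
  set t₁ := 2 ^ k₁ * (d * ⌊ρ1⌋₊ + 1) with ht₁
  set t₂ := 2 ^ k₂ * (d * ⌊ρ2⌋₊ + 1) with ht₂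
  have hstage1 : ∀ v : Fin d → ℤ, (percMeasure q hq).real
      {ω | ¬ DistLE (subGraph ω (cube v R)) (cube v R) R t₁} ≤ p x := by
    intro v
    have hRle : (R : ℝ) ≤ ρ1 ^ g ^ k₁ := by
      rw [hρ1def, ← Real.rpow_mul hx0.le]
      calc (R : ℝ) ≤ x ^ K * 3 := by linarith
        _ ≤ x ^ K * x := by gcongr; linarith
        _ = x ^ (K + 1) := (Real.rpow_add_one hx0.ne' _).symm
        _ ≤ _ := Real.rpow_le_rpow_of_exponent_le hx1 (by linarith)
    refine (measureReal_not_distLE_cube_le (by linarith) hb hedge v R hρ1' hρ1 hg.le hκ.le k₁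
      hRle).trans ?_
    have e1 : (((R : ℝ) + 1) ^ d) ^ 2 ≤ 9 ^ d * x ^ (2 * d * K) := by
      calc (((R : ℝ) + 1) ^ d) ^ 2 ≤ ((3 * x ^ K) ^ d) ^ 2 := by gcongr
        _ = 9 ^ d * x ^ (2 * d * K) := by
          rw [show (2 * d * K : ℝ) = K * ((d * 2 : ℕ) : ℝ) by push_cast; ring,
            Real.rpow_mul hx0.le, Real.rpow_natCast, ← pow_mul, mul_pow, mul_comm d 2,
            pow_mul 3 2 d]
          norm_num
    have e2 : ρ1 ^ κ / (36 ^ d * 2 ^ b) = c * x ^ (ε / 4 * κ) := by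
      rw [hρ1def, ← Real.rpow_mul hx0.le, hc, div_eq_inv_mul]
    rw [← hκdef, e2]
    calc _ ≤ (k₁ : ℝ) * ((9 ^ d * x ^ (2 * d * K)) * Real.exp (-(c * x ^ (ε / 4 * κ)))) := by
          gcongr
      _ = p x := by simp only [p]; ring
  set w : Fin d → ℤ := fun _ => -(L : ℤ) with hw
  have hN2 : ((((2 * L : ℕ) : ℝ) + 1) ^ d) ^ 2 ≤ Real.exp (4 * d * x) := by
    calc ((((2 * L : ℕ) : ℝ) + 1) ^ d) ^ 2 ≤ (Real.exp (2 * x) ^ d) ^ 2 := by gcongr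
      _ = Real.exp (4 * d * x) := by
        rw [← Real.exp_nat_mul, ← Real.exp_nat_mul]; congr 1; push_cast; ring
  have hNd : (((2 * L : ℕ) : ℝ) + 1) ^ d ≤ Real.exp (2 * d * x) := by
    calc (((2 * L : ℕ) : ℝ) + 1) ^ d ≤ Real.exp (2 * x) ^ d := by gcongr
      _ = Real.exp (2 * d * x) := by rw [← Real.exp_nat_mul]; congr 1; ring
  have hstage2 : (percMeasure q hq).real {ω | ¬ DistLE (subGraph ω (cube w (2 * L)))
      (cube w (2 * L)) ((n * (R + 1) : ℕ) : ℝ) t₂} ≤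
      k₂ * x ^ (0 : ℝ) * Real.exp (4 * d * x - c₂ * x ^ ((Δ + ε / 2) * κ₂)) := by
    have hle : ((n * (R + 1) : ℕ) : ℝ) ≤ ρ2 ^ g₂ ^ k₂ := by
      rw [hρ2def, ← Real.rpow_mul hx0.le]
      exact hh3.trans (Real.rpow_le_rpow_of_exponent_le hx1 (by linarith))
    refine (measureReal_not_distLE_cube_le (by linarith) hb₂ hedge₂ w (2 * L) hρ2' hρ2 hg₂.le
      hκ₂0.le k₂ hle).trans ?_
    have e2 : ρ2 ^ κ₂ / (36 ^ d * 2 ^ b₂) = c₂ * x ^ ((Δ + ε / 2) * κ₂) := by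
      rw [hρ2def, ← Real.rpow_mul hx0.le, hc₂, div_eq_inv_mul]
    rw [← hκ₂def, e2, Real.rpow_zero, mul_one, sub_eq_add_neg, Real.exp_add]
    gcongr
  have hmain := measureReal_diam_le hd' (by linarith) hb hedge w hn0 hhN
    (Real.one_le_rpow hx1 (by linarith) : 1 ≤ x ^ (K + 4)) (hρK.trans hR1) hh4 hg.le hκ.le hkN
    hstage1 hstage2
  have hsub : {ω : Config d | ENNReal.ofReal (x ^ (Δ + ε)) < (boxDiam ω L : ℝ≥0∞)} ⊆
      {ω | ¬ ∀ y ∈ cube w (2 * L), ∀ z ∈ cube w (2 * L),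
        (subGraph ω (cube w (2 * L))).edist y z ≤ (2 * t₂ + 2 ^ k * (2 * t₁ + 2) : ℕ)} := by
    intro ω hω hcon
    have hbd := boxDiam_le hcon
    have hfl : ∀ {ρ : ℝ} (k : ℕ), 1 ≤ ρ →
        ((2 ^ k * (d * ⌊ρ⌋₊ + 1) : ℕ) : ℝ) ≤ 2 ^ k * (d + 1) * ρ := by
      intro ρ k hρ
      push_cast
      rw [mul_assoc]
      gcongr
      have := mul_le_mul_of_nonneg_left (Nat.floor_le (by linarith : 0 ≤ ρ)) (Nat.cast_nonneg d)
      linarith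
    have hreal : ((2 * t₂ + 2 ^ k * (2 * t₁ + 2) : ℕ) : ℝ) ≤ x ^ (Δ + ε) := by
      have h1 : (t₁ : ℝ) ≤ 2 ^ k₁ * (d + 1) * x ^ (ε / 4) := hfl k₁ hρ1'
      have h2 : (t₂ : ℝ) ≤ 2 ^ k₂ * (d + 1) * x ^ (Δ + ε / 2) := hfl k₂ hρ2'
      have h3 : (2 : ℝ) ^ k ≤ 2 * (2 ^ (Δ + ε / 4) * x ^ (Δ + ε / 4)) := by
        refine hk2.trans ?_
        rw [← Real.mul_rpow (by norm_num) hx0.le]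
        gcongr 2 * ?_
        calc _ ≤ Real.log ((2 * L : ℕ) : ℝ) ^ (Δ + ε / 4) :=
              Real.rpow_le_rpow_of_exponent_le hlog2L' hgΔ
          _ ≤ _ := by gcongr
      have h4 : x ^ (Δ + ε / 2) = x ^ (Δ + ε / 4) * x ^ (ε / 4) := by
        rw [← Real.rpow_add hx0]; congr 1; ring
      have h5 : x ^ (Δ + ε) = x ^ (Δ + ε / 2) * x ^ (ε / 2) := by
        rw [← Real.rpow_add hx0]; congr 1; ring
      push_cast
      calc (2 : ℝ) * t₂ + 2 ^ k * (2 * t₁ + 2)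
          ≤ 2 * (2 ^ k₂ * (d + 1) * x ^ (Δ + ε / 2)) +
            2 * (2 ^ (Δ + ε / 4) * x ^ (Δ + ε / 4)) *
              (2 * (2 ^ k₁ * (d + 1) * x ^ (ε / 4)) + 2 * x ^ (ε / 4)) := by
            gcongr
            linarith
        _ = D * x ^ (Δ + ε / 2) := by rw [h4, hD]; ring
        _ ≤ x ^ (ε / 2) * x ^ (Δ + ε / 2) := by gcongr
        _ = x ^ (Δ + ε) := by rw [h5, mul_comm]
    refine absurd hω (not_lt.2 ((ENat.toENNReal_le.2 hbd).trans ?_))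
    rw [ENat.toENNReal_coe, ← ENNReal.ofReal_natCast]
    exact ENNReal.ofReal_le_ofReal hreal
  refine (measureReal_mono hsub (measure_ne_top _ _)).trans (hmain.trans ?_)
  have b2 : (((2 * L : ℕ) : ℝ) + 1) ^ d * p x ^ n ≤
      1 * x ^ (0 : ℝ) * Real.exp (2 * d * x - 1 * x ^ (2 : ℝ)) := by
    rw [Real.rpow_zero, mul_one, one_mul, one_mul, sub_eq_add_neg, Real.exp_add]
    have hp0 : 0 ≤ p x := by positivity
    -- Failure probability at most 1/e per trial and at least x² trials beat the number exp(O(x)) of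
    -- blocks.
    have h1 : p x ^ n ≤ Real.exp (-x ^ (2 : ℝ)) := by
      calc p x ^ n ≤ Real.exp (-1) ^ n := by gcongr
        _ = Real.exp (-n) := by rw [← Real.exp_nat_mul]; congr 1; ring
        _ ≤ _ := Real.exp_le_exp.2 (neg_le_neg hn1)
    gcongr
  have b3 : ((((2 * L : ℕ) : ℝ) + 1) ^ d) ^ 2 *
      Real.exp (-((((R : ℝ) / 3) ^ d) ^ 2 * (2 * x ^ (K + 4)) ^ (-b))) ≤
      1 * x ^ (0 : ℝ) * Real.exp (4 * d * x - (9 ^ d * 2 ^ b)⁻¹ * x ^ (2 * d * K - b * (K + 4))) := by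
    rw [Real.rpow_zero, mul_one, one_mul, sub_eq_add_neg, Real.exp_add]
    have h1 : (9 ^ d * 2 ^ b)⁻¹ * x ^ (2 * d * K - b * (K + 4)) =
        ((x ^ K / 3) ^ d) ^ 2 * (2 * x ^ (K + 4)) ^ (-b) := by
      rw [show (2 * d * K - b * (K + 4) : ℝ) = K * ((d * 2 : ℕ) : ℝ) + (K + 4) * -b by
          push_cast; ring, Real.rpow_add hx0, Real.rpow_mul hx0.le, Real.rpow_mul hx0.le,
        Real.rpow_natCast, Real.mul_rpow (by norm_num) (by positivity), Real.rpow_neg two_pos.le,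
        div_pow, div_pow, ← pow_mul, ← pow_mul, mul_comm d 2, pow_mul 3 2 d,
        show (3 : ℝ) ^ 2 = 9 by norm_num]
      field_simp
    rw [h1]
    gcongr
  have b4 : (k : ℝ) * (((((2 * L : ℕ) : ℝ) + 1) ^ d) ^ 2 *
      Real.exp (-((x ^ (K + 4)) ^ κ / (36 ^ d * 2 ^ b * n ^ 2)))) ≤
      (2 / Real.log g + 1) * x ^ (1 : ℝ) * Real.exp (4 * d * x - c / 4 * x ^ (κ * (K + 4) - 4)) := by
    rw [Real.rpow_one, sub_eq_add_neg, Real.exp_add]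
    have h1 : (k : ℝ) ≤ (2 / Real.log g + 1) * x := by
      calc (k : ℝ) ≤ (2 * x) / Real.log g + 1 := hk3.trans (by gcongr)
        _ ≤ (2 * x) / Real.log g + x := by linarith
        _ = _ := by ring
    have h2 : c / 4 * x ^ (κ * (K + 4) - 4) ≤ (x ^ (K + 4)) ^ κ / (36 ^ d * 2 ^ b * n ^ 2) := by
      have h3 : c / 4 * x ^ (κ * (K + 4) - 4) =
          (x ^ (K + 4)) ^ κ / (36 ^ d * 2 ^ b * (2 * x ^ (2 : ℝ)) ^ 2) := by
        rw [Real.rpow_sub hx0, mul_comm κ, Real.rpow_mul hx0.le, hc, mul_pow,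
          show (x ^ (2 : ℝ)) ^ 2 = x ^ (4 : ℝ) by
            rw [← Real.rpow_natCast, ← Real.rpow_mul hx0.le]; norm_num]
        field_simp
        norm_num
      rw [h3]
      have hn0' : (0 : ℝ) < n := by exact_mod_cast hn0
      gcongr
    gcongr
  exact add_le_add (add_le_add (add_le_add le_rfl b2) b3) b4

end

end LongRangePercolation

/-! ### Combination of the two bounds -/

theorem theorem1p1 (d : ℕ) (q : (Fin d → ℤ) → ℝ≥0∞) (hq : Function.Even q) (s : ℝ)
    (hlim : LongRangePercolation.HasDecayExponent q s) (hs : s ∈ Set.Ioo (d : ℝ) (2 * d))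
    (ε : ℝ) (hε : 0 < ε) :
    Tendsto
      (fun L : ℕ => LongRangePercolation.percMeasure q hq
        {ω | ENNReal.ofReal (Real.log L ^ (LongRangePercolation.diamExponent d s - ε)) ≤
              (LongRangePercolation.boxDiam ω L : ℝ≥0∞) ∧
            (LongRangePercolation.boxDiam ω L : ℝ≥0∞) ≤
              ENNReal.ofReal (Real.log L ^ (LongRangePercolation.diamExponent d s + ε))})
      atTop (𝓝 1) := by
  have h1 := LongRangePercolation.tendsto_boxDiam_lt q hq hlim hs hε
  have h2 := LongRangePercolation.tendsto_lt_boxDiam q hq hlim hs hε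
  have h3 : Tendsto (fun L : ℕ => (LongRangePercolation.percMeasure q hq).real
        {ω | ENNReal.ofReal (Real.log L ^ (LongRangePercolation.diamExponent d s - ε)) ≤
              (LongRangePercolation.boxDiam ω L : ℝ≥0∞) ∧
            (LongRangePercolation.boxDiam ω L : ℝ≥0∞) ≤
              ENNReal.ofReal (Real.log L ^ (LongRangePercolation.diamExponent d s + ε))})
      atTop (𝓝 1) := by
    have h4 := (tendsto_const_nhds (x := (1 : ℝ))).sub (h1.add h2)
    rw [add_zero, sub_zero] at h4
    refine tendsto_of_tendsto_of_tendsto_of_le_of_le h4 tendsto_const_nhds (fun L => ?_)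
      fun L => measureReal_le_one
    set A : Set (LongRangePercolation.Config d) :=
      {ω | ENNReal.ofReal (Real.log L ^ (LongRangePercolation.diamExponent d s - ε)) ≤
              (LongRangePercolation.boxDiam ω L : ℝ≥0∞) ∧
            (LongRangePercolation.boxDiam ω L : ℝ≥0∞) ≤
              ENNReal.ofReal (Real.log L ^ (LongRangePercolation.diamExponent d s + ε))}
    have hcover : (Set.univ : Set (LongRangePercolation.Config d)) ⊆ A ∪
        ({ω | (LongRangePercolation.boxDiam ω L : ℝ≥0∞) <
          ENNReal.ofReal (Real.log L ^ (LongRangePercolation.diamExponent d s - ε))} ∪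
        {ω | ENNReal.ofReal (Real.log L ^ (LongRangePercolation.diamExponent d s + ε)) <
          (LongRangePercolation.boxDiam ω L : ℝ≥0∞)}) := by
      intro ω _
      by_cases ha : ω ∈ A
      · exact Or.inl ha
      · right
        by_contra hcon
        simp only [Set.mem_union, Set.mem_ofPred_eq, not_or, not_lt] at hcon
        exact ha hcon
    have h5 := (measureReal_mono (μ := LongRangePercolation.percMeasure q hq) hcover
      (measure_ne_top _ _)).trans ((measureReal_union_le _ _).trans
        (add_le_add le_rfl (measureReal_union_le _ _)))
    rw [probReal_univ] at h5
    linarith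
  have h6 := ENNReal.tendsto_ofReal h3
  rw [ENNReal.ofReal_one] at h6
  exact h6.congr fun L => ofReal_measureReal (measure_ne_top _ _)
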